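/- **Setting.** A *dependent type theory* is a formal system that derives statements $\mathcal J\,[\Gamma]$, where $\Gamma=[x_0\in A_0,\ldots,x_{n-1}\in A_{n-1}(x_0,\ldots,x_{n-2})]$ is a context and $\mathcal J$ is a judgement of one of the forms $A\in\mathrm{Type}$, $a\in A$, $A=B\in\mathrm{Type}$, $a=b\in A$. Its expressions are built from variables by arbitrary type and term constructors, which may bind variables. A statement is derivable only if its context and the types and terms that occur in the judgement are well-formed. The derivable statements are closed under the variable axiom, weakening and substitution; under reflexivity, symmetry and transitivity of definitional equality; under the rules that $a\in A$ and $A=B$ give $a\in B$, and that $a=b\in A$ and $A=B$ give $a=b\in B$; and under congruence (substituting definitionally equal terms in a type or a term yields definitionally equal results). The theory may have any further rules. In particular no unit type and no $\Sigma$-types are assumed. The theory has *propositional identity types* if it has constructors $\mathrm{Id},\mathbf r,\mathbf J,\mathbf H$, commuting with substitution, that satisfy the congruence rules and, in every ambient context, the following rules. - Formation: if $a\in A$ and $b\in A$, then $\mathrm{Id}_A(a,b)\in\mathrm{Type}$. - Introduction: if $a\in A$, then $\mathbf r(a)\in\mathrm{Id}_A(a,a)$. - Elimination: if $C(x,y,u)\in\mathrm{Type}\,[x\in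 A,y\in A,u\in\mathrm{Id}_A(x,y),\Delta(x,y,u)]$, $a,b\in A$, $p\in\mathrm{Id}_A(a,b)$ and $d(x)\in C(x,x,\mathbf r(x))\,[x\in A,\Delta(x,x,\mathbf r(x))]$, then $\mathbf J(a,b,p,d)\in C(a,b,p)\,[\Delta(a,b,p)]$. - Computation: if $C$ and $d$ are as in the elimination rule and $a\in A$, then $\mathbf H(a,d)\in\mathrm{Id}_{C(a,a,\mathbf r(a))}\bigl(\mathbf J(a,a,\mathbf r(a),d),d(a)\bigr)\,[\Delta(a,a,\mathbf r(a))]$. The *classifying category* of the theory has as objects the well-formed contexts up to definitional equality of contexts of the same length. A morphism $\Delta\to\Gamma$, with $\Gamma$ as above, is a sequence $(t_0,\ldots,t_{n-1})$ with $t_i\in A_i(t_0,\ldots,t_{i-1})\,[\Delta]$ for all $i$, up to definitional equality; composition is substitution. A *fibration* is a morphism isomorphic (as an arrow) to a dependent projection $[\Gamma,\Delta]\to[\Gamma]$, which drops a final segment of a context. A *path category* is a category with two classes of maps, fibrations and weak equivalences (maps in both classes are called acyclic fibrations), such that: 1. isomorphisms are fibrations, and fibrations are closed under composition; 2. the pullback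 of a fibration along any map exists and is a fibration; 3. there is a terminal object $1$, and every map $X\to1$ is a fibration; 4. isomorphisms are weak equivalences; 5. if $f:A\to B$, $g:B\to C$, $h:C\to D$ are maps such that $gf$ and $hg$ are weak equivalences, then so are $f,g,h$ and $hgf$; 6. for every object $B$ the diagonal $B\to B\times B$ factors as a weak equivalence $r:B\to PB$ followed by a fibration $(s,t):PB\to B\times B$; 7. every acyclic fibration has a section; 8. the pullback of an acyclic fibration along any map is an acyclic fibration. **Theorem.** The classifying category of any dependent type theory with propositional identity types carries the structure of a path category: there is a class of weak equivalences which, together with the fibrations defined above, satisfies axioms 1–8. -/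

import Mathlib

open CategoryTheory CategoryTheory.Limits

universe u v

namespace DepTT

/-! ### Raw expressions -/

/-- A signature of type and term constructors. A constructor `f` takes `arity f` arguments, and its
`i`-th argument binds `binds f i` variables. -/
structure Signature : Type (u + 1) where
  Op : Type u
  arity : Op → ℕ
  binds : (f : Op) → Fin (arity f) → ℕ

/-- Raw expressions (for types and for terms) with free variables `x_0, …, x_{n-1}`, up to renaming
of bound variables. The variables bound in an argument are numbered from `n` on. -/
inductive Expr (S : Signature.{u}) : ℕ → Type u
  | var {n : ℕ} (i : Fin n) : Expr S n
  | op {n : ℕ} (f : S.Op) (args : (i : Fin (S.arity f)) → Expr S (n + S.binds f i)) : Expr S n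

variable {S : Signature.{u}}

/-- A sequence of `n` expressions in `m` variables, to be substituted for `x_0, …, x_{n-1}`. -/
abbrev Sub (S : Signature.{u}) (n m : ℕ) : Type u := Fin n → Expr S m

/-- A renaming, extended by the identity to `k` further variables. -/
def liftRen {n m : ℕ} (k : ℕ) (ρ : Fin n → Fin m) : Fin (n + k) → Fin (m + k) :=
  Fin.addCases (fun i => Fin.castAdd k (ρ i)) (fun j => Fin.natAdd m j)

namespace Expr

/-- Renaming of free variables. -/
def rename : ∀ {n m : ℕ}, Expr S n → (Fin n → Fin m) → Expr S m
  | _, _, var i, ρ => var (ρ i)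
  | _, _, op f args, ρ => op f (fun i => (args i).rename (liftRen (S.binds f i) ρ))

end Expr

/-- A substitution, extended by the identity to `k` further variables. -/
def Sub.lift {n m : ℕ} (k : ℕ) (σ : Sub S n m) : Sub S (n + k) (m + k) :=
  Fin.addCases (fun i => (σ i).rename (Fin.castAdd k)) (fun j => Expr.var (Fin.natAdd m j))

namespace Expr

/-- Simultaneous capture-avoiding substitution. -/
def subst : ∀ {n m : ℕ}, Expr S n → Sub S n m → Expr S m
  | _, _, var i, σ => σ i
  | _, _, op f args, σ => op f (fun i => (args i).subst (Sub.lift (S.binds f i) σ))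

end Expr

namespace Sub

/-- `(x_0, …, x_{n-1})` -/
def id (S : Signature.{u}) (n : ℕ) : Sub S n n := Expr.var

/-- `(x_0, …, x_{n-1})`, regarded as expressions in one more variable. -/
def wk (S : Signature.{u}) (n : ℕ) : Sub S n (n + 1) := fun i => Expr.var i.castSucc

/-- Adding one more expression to a sequence. -/
def snoc {n m : ℕ} (σ : Sub S n m) (a : Expr S m) : Sub S (n + 1) m :=
  Fin.snoc (α := fun _ => Expr S m) σ a

/-- The first `n` of `n + 1` expressions. -/
def init {n m : ℕ} (σ : Sub S (n + 1) m) : Sub S n m := fun i => σ i.castSucc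

/-- Substitution in a sequence of expressions. -/
def comp {n m k : ℕ} (σ : Sub S n m) (τ : Sub S m k) : Sub S n k := fun i => (σ i).subst τ

/-- `[a/x]` for the last variable `x`. -/
def inst {n : ℕ} (a : Expr S n) : Sub S (n + 1) n := snoc (id S n) a

end Sub

/-- The last variable. -/
def Expr.last (S : Signature.{u}) (n : ℕ) : Expr S (n + 1) := Expr.var (Fin.last n)

/-- An expression, regarded as an expression in one more variable. -/
def Expr.wk {n : ℕ} (e : Expr S n) : Expr S (n + 1) := e.subst (Sub.wk S n)

section SubstitutionLemmas

theorem Expr.rename_op {n m : ℕ} (f : S.Op) (args : (i : Fin (S.arity f)) → Expr S (n + S.binds f i))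
    (ρ : Fin n → Fin m) : (Expr.op f args).rename ρ
      = Expr.op f (fun i => (args i).rename (liftRen (S.binds f i) ρ)) := rfl

theorem Expr.subst_op {n m : ℕ} (f : S.Op) (args : (i : Fin (S.arity f)) → Expr S (n + S.binds f i))
    (σ : Sub S n m) : (Expr.op f args).subst σ
      = Expr.op f (fun i => (args i).subst (Sub.lift (S.binds f i) σ)) := rfl

theorem Expr.rename_var {n m : ℕ} (i : Fin n) (ρ : Fin n → Fin m) :
    (Expr.var i : Expr S n).rename ρ = Expr.var (ρ i) := rfl

theorem Expr.subst_var {n m : ℕ} (i : Fin n) (σ : Sub S n m) :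
    (Expr.var i : Expr S n).subst σ = σ i := rfl

theorem Expr.subst_rename {n : ℕ} (e : Expr S n) : ∀ {m k : ℕ} (ρ : Fin n → Fin m) (σ : Sub S m k),
    (e.rename ρ).subst σ = e.subst (fun i => σ (ρ i)) := by
  induction e with
  | var i => intros; rfl
  | op f args ih =>
    intro m k ρ σ
    rw [Expr.rename_op, Expr.subst_op, Expr.subst_op]
    congr 1; funext i
    rw [ih]
    congr 1; funext j
    refine Fin.addCases (fun a => ?_) (fun b => ?_) j <;> simp [Sub.lift, liftRen]

theorem Expr.rename_rename {n : ℕ} (e : Expr S n) : ∀ {m k : ℕ} (ρ : Fin n → Fin m)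
    (ρ' : Fin m → Fin k), (e.rename ρ).rename ρ' = e.rename (fun i => ρ' (ρ i)) := by
  induction e with
  | var i => intros; rfl
  | op f args ih =>
    intro m k ρ σ
    rw [Expr.rename_op, Expr.rename_op, Expr.rename_op]
    congr 1; funext i
    rw [ih]
    congr 1; funext j
    refine Fin.addCases (fun a => ?_) (fun b => ?_) j <;> simp [liftRen]

theorem Expr.rename_subst {n : ℕ} (e : Expr S n) : ∀ {m k : ℕ} (σ : Sub S n m) (ρ : Fin m → Fin k),
    (e.subst σ).rename ρ = e.subst (fun i => (σ i).rename ρ) := by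
  induction e with
  | var i => intros; rfl
  | op f args ih =>
    intro m k σ ρ
    rw [Expr.subst_op, Expr.rename_op, Expr.subst_op]
    congr 1; funext i
    rw [ih]
    congr 1; funext j
    refine Fin.addCases (fun a => ?_) (fun b => ?_) j
    · simp [Sub.lift, liftRen, Expr.rename_rename]
    · simp [Sub.lift, liftRen, Expr.rename_var]

theorem Sub.lift_comp {n m l : ℕ} (k : ℕ) (σ : Sub S n m) (τ : Sub S m l) :
    (Sub.lift k σ).comp (Sub.lift k τ) = Sub.lift k (σ.comp τ) := by
  funext j
  refine Fin.addCases (fun a => ?_) (fun b => ?_) j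
  · simp [Sub.lift, Sub.comp, Expr.subst_rename, Expr.rename_subst]
  · simp [Sub.lift, Sub.comp, Expr.subst_var]

theorem Expr.subst_subst {n : ℕ} (e : Expr S n) : ∀ {m k : ℕ} (σ : Sub S n m) (τ : Sub S m k),
    (e.subst σ).subst τ = e.subst (σ.comp τ) := by
  induction e with
  | var i => intros; rfl
  | op f args ih =>
    intro m k σ τ
    rw [Expr.subst_op, Expr.subst_op, Expr.subst_op]
    congr 1; funext i
    rw [ih, Sub.lift_comp]

theorem Sub.lift_id (n k : ℕ) : Sub.lift k (Sub.id S n) = Sub.id S (n + k) := by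
  funext j
  refine Fin.addCases (fun a => ?_) (fun b => ?_) j <;>
    simp [Sub.lift, Sub.id, Expr.rename_var]

theorem Expr.subst_id {n : ℕ} (e : Expr S n) : e.subst (Sub.id S n) = e := by
  induction e with
  | var i => rfl
  | op f args ih =>
    rw [Expr.subst_op]
    congr 1; funext i
    rw [Sub.lift_id, ih]

theorem Sub.id_comp {n m : ℕ} (σ : Sub S n m) : (Sub.id S n).comp σ = σ := rfl

theorem Sub.comp_id {n m : ℕ} (σ : Sub S n m) : σ.comp (Sub.id S m) = σ :=
  funext fun _ => Expr.subst_id _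

theorem Sub.comp_assoc {n m k l : ℕ} (σ : Sub S n m) (τ : Sub S m k) (υ : Sub S k l) :
    (σ.comp τ).comp υ = σ.comp (τ.comp υ) :=
  funext fun _ => Expr.subst_subst _ _ _

theorem Sub.snoc_castSucc {n m : ℕ} (σ : Sub S n m) (a : Expr S m) (i : Fin n) :
    σ.snoc a i.castSucc = σ i := by simp [Sub.snoc]

theorem Sub.snoc_last {n m : ℕ} (σ : Sub S n m) (a : Expr S m) :
    σ.snoc a (Fin.last n) = a := by simp [Sub.snoc]

theorem Sub.init_snoc {n m : ℕ} (σ : Sub S n m) (a : Expr S m) : (σ.snoc a).init = σ :=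
  funext fun _ => Sub.snoc_castSucc _ _ _

theorem Sub.snoc_init {n m : ℕ} (σ : Sub S (n + 1) m) : σ.init.snoc (σ (Fin.last n)) = σ := by
  funext i
  refine Fin.lastCases ?_ (fun j => ?_) i
  · rw [Sub.snoc_last]
  · rw [Sub.snoc_castSucc]; rfl

theorem Sub.wk_comp {n m : ℕ} (σ : Sub S (n + 1) m) : (Sub.wk S n).comp σ = σ.init := rfl

theorem Sub.snoc_comp {n m k : ℕ} (σ : Sub S n m) (a : Expr S m) (τ : Sub S m k) :
    (σ.snoc a).comp τ = (σ.comp τ).snoc (a.subst τ) := by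
  funext i
  refine Fin.lastCases ?_ (fun j => ?_) i
  · simp [Sub.comp, Sub.snoc_last]
  · simp [Sub.comp, Sub.snoc_castSucc]

theorem Sub.lift_one {n m : ℕ} (σ : Sub S n m) :
    Sub.lift 1 σ = (σ.comp (Sub.wk S m)).snoc (Expr.last S m) := by
  funext i
  refine Fin.lastCases ?_ (fun j => ?_) i
  · rw [Sub.snoc_last]
    exact Fin.addCases_right (0 : Fin 1)
  · rw [Sub.snoc_castSucc]
    refine (Fin.addCases_left j).trans ?_
    have h := Expr.subst_rename (σ j) (Fin.castAdd 1) (Sub.id S (m + 1))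
    rw [Expr.subst_id] at h
    exact h

theorem Sub.lift_one_inst {n m : ℕ} (σ : Sub S n m) (a : Expr S m) :
    (Sub.lift 1 σ).comp (Sub.inst a) = σ.snoc a := by
  rw [Sub.lift_one, Sub.snoc_comp, Sub.comp_assoc]
  have h1 : (Sub.wk S m).comp (Sub.inst a) = Sub.id S m := by
    rw [Sub.wk_comp]; exact Sub.init_snoc _ _
  have h2 : (Expr.last S m).subst (Sub.inst a) = a := Sub.snoc_last _ _
  rw [h1, h2, Sub.comp_id]

end SubstitutionLemmas

/-! ### Contexts and judgements -/

/-- Contexts `[x_0 ∈ A_0, …, x_{n-1} ∈ A_{n-1}(x_0, …, x_{n-2})]` (raw). -/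
inductive Ctx (S : Signature.{u}) : ℕ → Type u
  | nil : Ctx S 0
  | snoc {n : ℕ} (Γ : Ctx S n) (A : Expr S n) : Ctx S (n + 1)

/-- Telescopes of length `m` over a context of length `n`, that is, the lists `Δ` of types with which
a context `Γ` of length `n` can be extended to a context `[Γ, Δ]` of length `n + m` (raw). -/
inductive Tel (S : Signature.{u}) (n : ℕ) : ℕ → Type u
  | nil : Tel S n 0
  | snoc {m : ℕ} (Δ : Tel S n m) (A : Expr S (n + m)) : Tel S n (m + 1)

/-- The context `[Γ, Δ]`. -/
def Ctx.append {n : ℕ} (Γ : Ctx S n) : ∀ {m : ℕ}, Tel S n m → Ctx S (n + m)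
  | _, .nil => Γ
  | _, .snoc Δ A => (Γ.append Δ).snoc A

/-- Substitution in a telescope. -/
def Tel.subst {n k : ℕ} : ∀ {m : ℕ}, Tel S n m → Sub S n k → Tel S k m
  | _, .nil, _ => .nil
  | m + 1, .snoc Δ A, σ => (Δ.subst σ).snoc (A.subst (Sub.lift m σ))

/-- The four forms of judgement: `A ∈ Type`, `a ∈ A`, `A = B ∈ Type` and `a = b ∈ A`. -/
inductive Judgement (S : Signature.{u}) (n : ℕ) : Type u
  | isType (A : Expr S n)
  | hasType (a A : Expr S n)
  | eqType (A B : Expr S n)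
  | eqTerm (a b A : Expr S n)

/-- Substitution in a judgement. -/
def Judgement.subst {n m : ℕ} : Judgement S n → Sub S n m → Judgement S m
  | isType A, σ => isType (A.subst σ)
  | hasType a A, σ => hasType (a.subst σ) (A.subst σ)
  | eqType A B, σ => eqType (A.subst σ) (B.subst σ)
  | eqTerm a b A, σ => eqTerm (a.subst σ) (b.subst σ) (A.subst σ)

open Judgement

/-! ### Type theories -/

/-- A dependent type theory over the signature `S`, given by its derivable statements `J [Γ]`. These
are closed under the basic rules of type theory, and they may contain anything besides. -/
structure TypeTheory (S : Signature.{u}) where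
  /-- The statement `J [Γ]` is derivable. -/
  Derivable : ∀ {n : ℕ}, Ctx S n → Judgement S n → Prop
  -- A statement is derivable only if its context and the constituents of the judgement are well-formed.
  ctx_wf : ∀ {n : ℕ} {Γ : Ctx S n} {A : Expr S n} {𝓙 : Judgement S (n + 1)},
    Derivable (Γ.snoc A) 𝓙 → Derivable Γ (isType A)
  hasType_wf : ∀ {n : ℕ} {Γ : Ctx S n} {a A : Expr S n},
    Derivable Γ (hasType a A) → Derivable Γ (isType A)
  eqType_wf : ∀ {n : ℕ} {Γ : Ctx S n} {A B : Expr S n},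
    Derivable Γ (eqType A B) → Derivable Γ (isType A) ∧ Derivable Γ (isType B)
  eqTerm_wf : ∀ {n : ℕ} {Γ : Ctx S n} {a b A : Expr S n},
    Derivable Γ (eqTerm a b A) → Derivable Γ (hasType a A) ∧ Derivable Γ (hasType b A)
  -- Axiom, weakening and substitution.
  var_mem : ∀ {n : ℕ} {Γ : Ctx S n} {A : Expr S n},
    Derivable Γ (isType A) → Derivable (Γ.snoc A) (hasType (Expr.last S n) A.wk)
  weakening : ∀ {n m : ℕ} {Γ : Ctx S n} {Δ : Tel S n m} {𝓙 : Judgement S (n + m)} {A : Expr S n},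
    Derivable (Γ.append Δ) 𝓙 → Derivable Γ (isType A) →
      Derivable ((Γ.snoc A).append (Δ.subst (Sub.wk S n))) (𝓙.subst (Sub.lift m (Sub.wk S n)))
  substitution : ∀ {n m : ℕ} {Γ : Ctx S n} {A : Expr S n} {Δ : Tel S (n + 1) m}
    {𝓙 : Judgement S (n + 1 + m)} {a : Expr S n},
    Derivable ((Γ.snoc A).append Δ) 𝓙 → Derivable Γ (hasType a A) →
      Derivable (Γ.append (Δ.subst (Sub.inst a))) (𝓙.subst (Sub.lift m (Sub.inst a)))
  -- Definitional equality is an equivalence relation.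
  type_refl : ∀ {n : ℕ} {Γ : Ctx S n} {A : Expr S n},
    Derivable Γ (isType A) → Derivable Γ (eqType A A)
  type_symm : ∀ {n : ℕ} {Γ : Ctx S n} {A B : Expr S n},
    Derivable Γ (eqType A B) → Derivable Γ (eqType B A)
  type_trans : ∀ {n : ℕ} {Γ : Ctx S n} {A B C : Expr S n},
    Derivable Γ (eqType A B) → Derivable Γ (eqType B C) → Derivable Γ (eqType A C)
  term_refl : ∀ {n : ℕ} {Γ : Ctx S n} {a A : Expr S n},
    Derivable Γ (hasType a A) → Derivable Γ (eqTerm a a A)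
  term_symm : ∀ {n : ℕ} {Γ : Ctx S n} {a b A : Expr S n},
    Derivable Γ (eqTerm a b A) → Derivable Γ (eqTerm b a A)
  term_trans : ∀ {n : ℕ} {Γ : Ctx S n} {a b c A : Expr S n},
    Derivable Γ (eqTerm a b A) → Derivable Γ (eqTerm b c A) → Derivable Γ (eqTerm a c A)
  -- Compatibility rules for definitional equality.
  hasType_conv : ∀ {n : ℕ} {Γ : Ctx S n} {a A B : Expr S n},
    Derivable Γ (hasType a A) → Derivable Γ (eqType A B) → Derivable Γ (hasType a B)
  eqTerm_conv : ∀ {n : ℕ} {Γ : Ctx S n} {a b A B : Expr S n},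
    Derivable Γ (eqTerm a b A) → Derivable Γ (eqType A B) → Derivable Γ (eqTerm a b B)
  -- Congruence: substituting definitionally equal terms gives definitionally equal results. For a
  -- theory in which every constructor has its congruence rules this follows from those rules.
  subst_congr_type : ∀ {n m : ℕ} {Γ : Ctx S n} {A : Expr S n} {Δ : Tel S (n + 1) m}
    {B : Expr S (n + 1 + m)} {a a' : Expr S n},
    Derivable ((Γ.snoc A).append Δ) (isType B) → Derivable Γ (eqTerm a a' A) →
      Derivable (Γ.append (Δ.subst (Sub.inst a)))
        (eqType (B.subst (Sub.lift m (Sub.inst a))) (B.subst (Sub.lift m (Sub.inst a'))))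
  subst_congr_term : ∀ {n m : ℕ} {Γ : Ctx S n} {A : Expr S n} {Δ : Tel S (n + 1) m}
    {b B : Expr S (n + 1 + m)} {a a' : Expr S n},
    Derivable ((Γ.snoc A).append Δ) (hasType b B) → Derivable Γ (eqTerm a a' A) →
      Derivable (Γ.append (Δ.subst (Sub.inst a)))
        (eqTerm (b.subst (Sub.lift m (Sub.inst a))) (b.subst (Sub.lift m (Sub.inst a')))
          (B.subst (Sub.lift m (Sub.inst a))))

namespace TypeTheory

variable (T : TypeTheory S)

/-- Well-formed contexts. -/
def Valid : ∀ {n : ℕ}, Ctx S n → Prop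
  | _, .nil => True
  | _, .snoc Γ A => Valid Γ ∧ T.Derivable Γ (isType A)

/-- Definitional equality of contexts of the same length. -/
def CtxEq : ∀ {n : ℕ}, Ctx S n → Ctx S n → Prop
  | _, .nil, .nil => True
  | _, .snoc Γ A, .snoc Γ' A' => CtxEq Γ Γ' ∧ T.Derivable Γ (eqType A A')

/-- `IsCtxMor T Δ Γ t` says that `t_i ∈ A_i(t_0, …, t_{i-1}) [Δ]` is derivable for every `i`, where
`Γ = [x_0 ∈ A_0, x_1 ∈ A_1(x_0), …]`. -/
def IsCtxMor {k : ℕ} (Δ : Ctx S k) : ∀ {n : ℕ}, Ctx S n → Sub S n k → Prop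
  | _, .nil, _ => True
  | n + 1, .snoc Γ A, t => IsCtxMor Δ Γ t.init ∧
      T.Derivable Δ (hasType (t (Fin.last n)) (A.subst t.init))

/-- `CtxMorEq T Δ Γ s t` says that `s_i = t_i ∈ A_i(t_0, …, t_{i-1}) [Δ]` is derivable for every `i`,
where `Γ = [x_0 ∈ A_0, x_1 ∈ A_1(x_0), …]`. -/
def CtxMorEq {k : ℕ} (Δ : Ctx S k) : ∀ {n : ℕ}, Ctx S n → Sub S n k → Sub S n k → Prop
  | _, .nil, _, _ => True
  | n + 1, .snoc Γ A, s, t => CtxMorEq Δ Γ s.init t.init ∧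
      T.Derivable Δ (eqTerm (s (Fin.last n)) (t (Fin.last n)) (A.subst t.init))

end TypeTheory

/-! ### Admissibility of simultaneous substitution

These facts are what the definition of the classifying category needs. -/

section Admissible

theorem Judgement.subst_subst {n m k : ℕ} (𝓙 : Judgement S n) (σ : Sub S n m) (τ : Sub S m k) :
    (𝓙.subst σ).subst τ = 𝓙.subst (σ.comp τ) := by
  cases 𝓙 <;> simp [Judgement.subst, Expr.subst_subst]

theorem Judgement.subst_id {n : ℕ} (𝓙 : Judgement S n) : 𝓙.subst (Sub.id S n) = 𝓙 := by
  cases 𝓙 <;> simp [Judgement.subst, Expr.subst_id]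

theorem Tel.subst_subst {n k l : ℕ} (σ : Sub S n k) (τ : Sub S k l) {m : ℕ} (Δ : Tel S n m) :
    (Δ.subst σ).subst τ = Δ.subst (σ.comp τ) := by
  induction Δ with
  | nil => rfl
  | snoc Δ A ih => simp [Tel.subst, ih, Expr.subst_subst, Sub.lift_comp]

theorem Tel.subst_id {n m : ℕ} (Δ : Tel S n m) : Δ.subst (Sub.id S n) = Δ := by
  induction Δ with
  | nil => rfl
  | snoc Δ A ih => simp [Tel.subst, ih, Expr.subst_id, Sub.lift_id]

/-- The change of indices along an equality of numbers of variables. -/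
def Sub.ofEq (S : Signature.{u}) {n m : ℕ} (h : n = m) : Sub S n m := fun i => Expr.var (Fin.cast h i)

theorem Sub.ofEq_rfl (n : ℕ) (h : n = n) : Sub.ofEq S h = Sub.id S n := rfl

/-- A context, with its length replaced by an equal number. -/
def Ctx.cast {n m : ℕ} (h : n = m) (Γ : Ctx S n) : Ctx S m := h ▸ Γ

/-- The telescope `[x ∈ A, Θ]`. -/
def Tel.cons {n : ℕ} (A : Expr S n) : ∀ {m : ℕ}, Tel S (n + 1) m → Tel S n (m + 1)
  | _, .nil => Tel.snoc .nil A
  | m + 1, .snoc Θ B => (Tel.cons A Θ).snoc (B.subst (Sub.ofEq S (Nat.add_right_comm n 1 m)))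

theorem Ctx.cast_snoc {n m : ℕ} (h : n = m) (h' : n + 1 = m + 1) (Γ : Ctx S n) (A : Expr S n) :
    (Γ.snoc A).cast h' = (Γ.cast h).snoc (A.subst (Sub.ofEq S h)) := by
  subst h
  rw [Sub.ofEq_rfl, Expr.subst_id]
  rfl

theorem Ctx.append_cons {n m : ℕ} (Γ : Ctx S n) (A : Expr S n) (Θ : Tel S (n + 1) m)
    (h : n + 1 + m = n + (m + 1)) : ((Γ.snoc A).append Θ).cast h = Γ.append (Tel.cons A Θ) := by
  induction Θ with
  | nil => rfl
  | @snoc m Θ B ih =>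
    have h' : n + 1 + m = n + (m + 1) := by omega
    exact (Ctx.cast_snoc h' h _ _).trans (by rw [ih h']; rfl)

theorem Sub.lift_ofEq {n k : ℕ} (m : ℕ) (σ : Sub S n k) (h : n + 1 + m = n + (m + 1))
    (h' : k + 1 + m = k + (m + 1)) :
    (Sub.ofEq S h).comp (Sub.lift (m + 1) σ) = (Sub.lift m (Sub.lift 1 σ)).comp (Sub.ofEq S h') := by
  have key : ∀ (e : Expr S k), (e.rename (Fin.castAdd (m + 1))) =
      ((e.rename (Fin.castAdd 1)).rename (Fin.castAdd m)).subst (Sub.ofEq S h') := by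
    intro e
    rw [Expr.rename_rename, Expr.subst_rename]
    have := Expr.subst_rename e (Fin.castAdd (m + 1)) (Sub.id S (k + (m + 1)))
    rw [Expr.subst_id] at this
    rw [this]
    rfl
  funext j
  refine Fin.addCases (fun a => ?_) (fun b => ?_) j
  · refine Fin.addCases (fun a => ?_) (fun b => ?_) a
    · have e1 : Fin.cast h (Fin.castAdd m (Fin.castAdd 1 a)) = Fin.castAdd (m + 1) a := rfl
      simp [Sub.comp, Sub.ofEq, Expr.subst_var, e1, Sub.lift]
      exact key _
    · have e1 : Fin.cast h (Fin.castAdd m (Fin.natAdd n b)) = Fin.natAdd n ⟨b, by omega⟩ := rfl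
      simp only [Sub.comp, Sub.ofEq, Expr.subst_var, e1, Sub.lift, Fin.addCases_left,
        Fin.addCases_right, Expr.rename_var]
      rfl
  · have e1 : Fin.cast h (Fin.natAdd (n + 1) b) = Fin.natAdd n ⟨1 + b, by omega⟩ := by
      ext; simp; omega
    simp only [Sub.comp, Sub.ofEq, Expr.subst_var, e1, Sub.lift, Fin.addCases_right]
    congr 1
    ext; simp; omega

theorem Sub.lift_zero {n k : ℕ} (σ : Sub S n k) : Sub.lift 0 σ = σ := by
  funext j
  refine (Fin.addCases_left (n := 0) j).trans ?_
  have h := Expr.subst_rename (σ j) (Fin.castAdd 0) (Sub.id S _)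
  rw [Expr.subst_id] at h
  exact h.trans (Expr.subst_id _)

theorem Tel.cons_subst {n k : ℕ} (σ : Sub S n k) (A : Expr S n) {m : ℕ} (Θ : Tel S (n + 1) m) :
    (Tel.cons A Θ).subst σ = Tel.cons (A.subst σ) (Θ.subst (Sub.lift 1 σ)) := by
  induction Θ with
  | nil =>
    simp only [Tel.cons, Tel.subst]
    exact congrArg (fun s => Tel.snoc Tel.nil (A.subst s)) (Sub.lift_zero σ)
  | snoc Θ B ih =>
    simp only [Tel.cons, Tel.subst, ih, Expr.subst_subst]
    rw [Sub.lift_ofEq]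

namespace TypeTheory

variable {T : TypeTheory S}

theorem derivable_cast {n m : ℕ} (h : n = m) (Γ : Ctx S n) (𝓙 : Judgement S n) :
    T.Derivable (Γ.cast h) (𝓙.subst (Sub.ofEq S h)) ↔ T.Derivable Γ 𝓙 := by
  subst h
  rw [Sub.ofEq_rfl, Judgement.subst_id]
  rfl

theorem derivable_cons {n m : ℕ} (Γ : Ctx S n) (A : Expr S n) (Θ : Tel S (n + 1) m)
    (𝓙 : Judgement S (n + 1 + m)) (h : n + 1 + m = n + (m + 1)) :
    T.Derivable (Γ.append (Tel.cons A Θ)) (𝓙.subst (Sub.ofEq S h)) ↔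
      T.Derivable ((Γ.snoc A).append Θ) 𝓙 := by
  rw [← Ctx.append_cons Γ A Θ h, derivable_cast]

theorem valid_of_derivable : ∀ {n : ℕ} {Γ : Ctx S n} {𝓙 : Judgement S n},
    T.Derivable Γ 𝓙 → T.Valid Γ
  | _, .nil, _, _ => trivial
  | _, .snoc _ _, _, h => ⟨valid_of_derivable (T.ctx_wf h), T.ctx_wf h⟩

theorem derivable_of_front {m : ℕ} {Θ : Tel S 0 m} {𝓙 : Judgement S (0 + m)}
    (h : T.Derivable (Ctx.nil.append Θ) 𝓙) : ∀ {k : ℕ} (Δ : Ctx S k), T.Valid Δ →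
      ∀ t : Sub S 0 k, T.Derivable (Δ.append (Θ.subst t)) (𝓙.subst (Sub.lift m t))
  | _, .nil, _, t => by
    have ht : t = Sub.id S 0 := funext fun i => i.elim0
    rwa [ht, Tel.subst_id, Sub.lift_id, Judgement.subst_id]
  | k + 1, .snoc Δ A, hv, t => by
    have := T.weakening (derivable_of_front h Δ hv.1 (fun i => i.elim0)) hv.2
    rw [Tel.subst_subst, Judgement.subst_subst, Sub.lift_comp] at this
    have ht : t = Sub.comp (fun i => i.elim0) (Sub.wk S k) := funext fun i => i.elim0
    rwa [← ht] at this

/-- Simultaneous substitution, under a telescope. -/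
theorem derivable_subst_tel {k : ℕ} {Δ : Ctx S k} (hΔ : T.Valid Δ) :
    ∀ {n : ℕ} {Γ : Ctx S n} {t : Sub S n k}, T.IsCtxMor Δ Γ t →
      ∀ {m : ℕ} (Θ : Tel S n m) {𝓙 : Judgement S (n + m)}, T.Derivable (Γ.append Θ) 𝓙 →
        T.Derivable (Δ.append (Θ.subst t)) (𝓙.subst (Sub.lift m t))
  | _, .nil, t, _, _, _, _, h => derivable_of_front h Δ hΔ t
  | n + 1, .snoc Γ A, t, ht, m, Θ, 𝓙, h => by
    have e : n + 1 + m = n + (m + 1) := by omega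
    have e' : k + 1 + m = k + (m + 1) := by omega
    have h1 := derivable_subst_tel hΔ ht.1 (Tel.cons A Θ) ((derivable_cons Γ A Θ 𝓙 e).2 h)
    rw [Tel.cons_subst, Judgement.subst_subst, Sub.lift_ofEq _ _ e e', ← Judgement.subst_subst,
      derivable_cons] at h1
    have h2 := T.substitution h1 ht.2
    rwa [Tel.subst_subst, Judgement.subst_subst, Sub.lift_comp, Sub.lift_one_inst,
      Sub.snoc_init] at h2

/-- Simultaneous substitution. -/
theorem derivable_subst {k n : ℕ} {Δ : Ctx S k} (hΔ : T.Valid Δ) {Γ : Ctx S n} {t : Sub S n k}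
    (ht : T.IsCtxMor Δ Γ t) {𝓙 : Judgement S n} (h : T.Derivable Γ 𝓙) :
    T.Derivable Δ (𝓙.subst t) := by
  have := derivable_subst_tel hΔ ht .nil (𝓙 := 𝓙) h
  exact (Sub.lift_zero t ▸ this :)

theorem derivable_wk {n : ℕ} {Γ : Ctx S n} {A : Expr S n} {𝓙 : Judgement S n}
    (h : T.Derivable Γ 𝓙) (hA : T.Derivable Γ (isType A)) :
    T.Derivable (Γ.snoc A) (𝓙.subst (Sub.wk S n)) := by
  have := T.weakening (Δ := .nil) (𝓙 := 𝓙) h hA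
  exact (Sub.lift_zero (Sub.wk S n) ▸ this :)

theorem IsCtxMor.wk {k : ℕ} {Δ : Ctx S k} {B : Expr S k} (hB : T.Derivable Δ (isType B)) :
    ∀ {n : ℕ} {Γ : Ctx S n} {t : Sub S n k}, T.IsCtxMor Δ Γ t →
      T.IsCtxMor (Δ.snoc B) Γ (t.comp (Sub.wk S k))
  | _, .nil, _, _ => trivial
  | _, .snoc Γ A, t, ht => by
    refine ⟨IsCtxMor.wk hB ht.1, ?_⟩
    have := derivable_wk ht.2 hB
    simp only [Judgement.subst, Expr.subst_subst] at this
    exact this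

/-- Definitionally equal contexts are related by the identity substitution. -/
theorem CtxEq.isCtxMor : ∀ {n : ℕ} {Γ Γ' : Ctx S n}, T.Valid Γ' → T.CtxEq Γ Γ' →
    T.IsCtxMor Γ' Γ (Sub.id S n)
  | _, .nil, .nil, _, _ => trivial
  | n + 1, .snoc Γ A, .snoc Γ' A', hv, h => by
    have ih := CtxEq.isCtxMor hv.1 h.1
    refine ⟨IsCtxMor.wk hv.2 ih, ?_⟩
    have h1 := derivable_subst hv.1 ih h.2
    rw [Judgement.subst_id] at h1
    exact T.hasType_conv (T.var_mem hv.2) (T.type_symm (derivable_wk h1 hv.2))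

theorem CtxEq.derivable {n : ℕ} {Γ Γ' : Ctx S n} (hv : T.Valid Γ') (h : T.CtxEq Γ Γ')
    {𝓙 : Judgement S n} (hJ : T.Derivable Γ 𝓙) : T.Derivable Γ' 𝓙 := by
  have := derivable_subst hv (CtxEq.isCtxMor hv h) hJ
  rwa [Judgement.subst_id] at this

theorem CtxEq.refl : ∀ {n : ℕ} {Γ : Ctx S n}, T.Valid Γ → T.CtxEq Γ Γ
  | _, .nil, _ => trivial
  | _, .snoc _ _, h => ⟨CtxEq.refl h.1, T.type_refl h.2⟩

theorem isCtxMor_id {n : ℕ} {Γ : Ctx S n} (h : T.Valid Γ) : T.IsCtxMor Γ Γ (Sub.id S n) :=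
  CtxEq.isCtxMor h (CtxEq.refl h)

theorem CtxEq.symm : ∀ {n : ℕ} {Γ Γ' : Ctx S n}, T.Valid Γ' → T.CtxEq Γ Γ' → T.CtxEq Γ' Γ
  | _, .nil, .nil, _, _ => trivial
  | _, .snoc _ _, .snoc _ _, hv, h =>
    ⟨CtxEq.symm hv.1 h.1, T.type_symm (h.1.derivable hv.1 h.2)⟩

theorem CtxEq.trans : ∀ {n : ℕ} {Γ Γ' Γ'' : Ctx S n}, T.Valid Γ → T.Valid Γ' →
    T.CtxEq Γ Γ' → T.CtxEq Γ' Γ'' → T.CtxEq Γ Γ''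
  | _, .nil, .nil, .nil, _, _, _, _ => trivial
  | _, .snoc _ _, .snoc _ _, .snoc _ _, hv, hv', h, h' =>
    ⟨CtxEq.trans hv.1 hv'.1 h.1 h'.1,
      T.type_trans h.2 (CtxEq.derivable hv.1 (CtxEq.symm hv'.1 h.1) h'.2)⟩

/-- Simultaneous substitution of definitionally equal terms, under a telescope. -/
theorem subst_congr_tel {k : ℕ} {Δ : Ctx S k} (hΔ : T.Valid Δ) :
    ∀ {n : ℕ} {Γ : Ctx S n} {s t : Sub S n k}, T.IsCtxMor Δ Γ s → T.IsCtxMor Δ Γ t →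
      T.CtxMorEq Δ Γ s t → ∀ {m : ℕ} (Θ : Tel S n m),
      (∀ {B : Expr S (n + m)}, T.Derivable (Γ.append Θ) (isType B) →
        T.Derivable (Δ.append (Θ.subst s))
          (eqType (B.subst (Sub.lift m s)) (B.subst (Sub.lift m t)))) ∧
      (∀ {b B : Expr S (n + m)}, T.Derivable (Γ.append Θ) (hasType b B) →
        T.Derivable (Δ.append (Θ.subst s))
          (eqTerm (b.subst (Sub.lift m s)) (b.subst (Sub.lift m t)) (B.subst (Sub.lift m s))))
  | _, .nil, s, t, _, _, _, m, Θ => by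
    have ht : t = s := funext fun i => i.elim0
    subst ht
    exact ⟨fun h => T.type_refl (derivable_of_front h Δ hΔ t),
      fun h => T.term_refl (derivable_of_front h Δ hΔ t)⟩
  | n + 1, .snoc Γ A, s, t, hs, ht, hst, m, Θ => by
    have step : ∀ {m : ℕ} (Θ : Tel S (n + 1) m),
      (∀ {B : Expr S (n + 1 + m)}, T.Derivable ((Γ.snoc A).append Θ) (isType B) →
        T.Derivable (Δ.append (Θ.subst s)) (eqType (B.subst (Sub.lift m s))
          (B.subst (Sub.lift m (t.init.snoc (s (Fin.last n))))))) ∧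
      (∀ {b B : Expr S (n + 1 + m)}, T.Derivable ((Γ.snoc A).append Θ) (hasType b B) →
        T.Derivable (Δ.append (Θ.subst s)) (eqTerm (b.subst (Sub.lift m s))
          (b.subst (Sub.lift m (t.init.snoc (s (Fin.last n))))) (B.subst (Sub.lift m s)))) := by
      intro m Θ
      have e : n + 1 + m = n + (m + 1) := by omega
      have e' : k + 1 + m = k + (m + 1) := by omega
      have ih := subst_congr_tel hΔ hs.1 ht.1 hst.1 (Tel.cons A Θ)
      have fix : ∀ 𝓙 : Judgement S (k + 1 + m),
          T.Derivable (Δ.append ((Tel.cons A Θ).subst s.init)) (𝓙.subst (Sub.ofEq S e')) →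
          T.Derivable (Δ.append (Θ.subst s)) (𝓙.subst (Sub.lift m (Sub.inst (s (Fin.last n))))) := by
        intro 𝓙 h
        rw [Tel.cons_subst, derivable_cons] at h
        have := T.substitution h hs.2
        rwa [Tel.subst_subst, Sub.lift_one_inst, Sub.snoc_init] at this
      have swap : ∀ (e0 : Expr S (n + 1 + m)) (r : Sub S n k),
          (e0.subst (Sub.ofEq S e)).subst (Sub.lift (m + 1) r) =
            (e0.subst (Sub.lift m (Sub.lift 1 r))).subst (Sub.ofEq S e') := by
        intro e0 r
        rw [Expr.subst_subst, Expr.subst_subst, Sub.lift_ofEq]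
      have done : ∀ (e0 : Expr S (n + 1 + m)) (r : Sub S n k) (a : Expr S k),
          (e0.subst (Sub.lift m (Sub.lift 1 r))).subst (Sub.lift m (Sub.inst a)) =
            e0.subst (Sub.lift m (r.snoc a)) := by
        intro e0 r a
        rw [Expr.subst_subst, Sub.lift_comp, Sub.lift_one_inst]
      constructor
      · intro B hB
        have h := ih.1 ((derivable_cons Γ A Θ _ e).2 hB)
        rw [swap, swap] at h
        have h' := fix (eqType _ _) h
        simp only [Judgement.subst] at h'
        rwa [done, done, Sub.snoc_init] at h'
      · intro b B hB
        have h := ih.2 ((derivable_cons Γ A Θ _ e).2 hB)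
        rw [swap, swap, swap] at h
        have h' := fix (eqTerm _ _ _) h
        simp only [Judgement.subst] at h'
        rwa [done, done, done, Sub.snoc_init] at h'
    have under : ∀ {𝓙 : Judgement S (n + 1 + m)}, T.Derivable ((Γ.snoc A).append Θ) 𝓙 →
        T.Derivable ((Δ.snoc (A.subst t.init)).append (Θ.subst (Sub.lift 1 t.init)))
          (𝓙.subst (Sub.lift m (Sub.lift 1 t.init))) := by
      intro 𝓙 h
      have e : n + 1 + m = n + (m + 1) := by omega
      have e' : k + 1 + m = k + (m + 1) := by omega
      have h1 := derivable_subst_tel hΔ ht.1 (Tel.cons A Θ) ((derivable_cons Γ A Θ 𝓙 e).2 h)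
      rwa [Tel.cons_subst, Judgement.subst_subst, Sub.lift_ofEq _ _ e e', ← Judgement.subst_subst,
        derivable_cons] at h1
    have tel : ∀ {m : ℕ} (Θ : Tel S (n + 1) m), T.Valid ((Γ.snoc A).append Θ) →
        T.CtxEq (Δ.append (Θ.subst s)) (Δ.append (Θ.subst (t.init.snoc (s (Fin.last n))))) := by
      intro m Θ
      induction Θ with
      | nil => intro _; exact CtxEq.refl hΔ
      | snoc Θ B ih => intro h; exact ⟨ih h.1, (step Θ).1 h.2⟩
    have conv : ∀ {𝓙 : Judgement S (k + m)}, T.Valid ((Γ.snoc A).append Θ) →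
        T.Valid (Δ.append (Θ.subst s)) →
        T.Derivable (Δ.append (Θ.subst (t.init.snoc (s (Fin.last n))))) 𝓙 →
        T.Derivable (Δ.append (Θ.subst s)) 𝓙 := by
      intro 𝓙 h1 h2 h3
      exact CtxEq.derivable h2 (CtxEq.symm (valid_of_derivable h3) (tel Θ h1)) h3
    have done : ∀ (e0 : Expr S (n + 1 + m)) (r : Sub S n k) (a : Expr S k),
        (e0.subst (Sub.lift m (Sub.lift 1 r))).subst (Sub.lift m (Sub.inst a)) =
          e0.subst (Sub.lift m (r.snoc a)) := by
      intro e0 r a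
      rw [Expr.subst_subst, Sub.lift_comp, Sub.lift_one_inst]
    constructor
    · intro B hB
      have h1 := (step Θ).1 hB
      have h2 := T.subst_congr_type (under hB) hst.2
      rw [Tel.subst_subst, Sub.lift_one_inst, done, done, Sub.snoc_init] at h2
      exact T.type_trans h1 (conv (valid_of_derivable hB) (valid_of_derivable h1) h2)
    · intro b B hb
      have h0 := (step Θ).1 (T.hasType_wf hb)
      have h1 := (step Θ).2 hb
      have h2 := T.subst_congr_term (under hb) hst.2
      rw [Tel.subst_subst, Sub.lift_one_inst, done, done, done, Sub.snoc_init] at h2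
      exact T.term_trans h1 (T.eqTerm_conv
        (conv (valid_of_derivable hb) (valid_of_derivable h1) h2) (T.type_symm h0))

/-- Simultaneous substitution of definitionally equal terms in a type. -/
theorem subst_congr_isType {k n : ℕ} {Δ : Ctx S k} (hΔ : T.Valid Δ) {Γ : Ctx S n} {s t : Sub S n k}
    (hs : T.IsCtxMor Δ Γ s) (ht : T.IsCtxMor Δ Γ t) (hst : T.CtxMorEq Δ Γ s t) {B : Expr S n}
    (hB : T.Derivable Γ (isType B)) : T.Derivable Δ (eqType (B.subst s) (B.subst t)) := by
  have h := subst_congr_tel hΔ hs ht hst .nil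
  have := h.1 (B := B) hB
  rw [Sub.lift_zero, Sub.lift_zero] at this
  exact this

/-- Simultaneous substitution of definitionally equal terms in a term. -/
theorem subst_congr_hasType {k n : ℕ} {Δ : Ctx S k} (hΔ : T.Valid Δ) {Γ : Ctx S n}
    {s t : Sub S n k} (hs : T.IsCtxMor Δ Γ s) (ht : T.IsCtxMor Δ Γ t) (hst : T.CtxMorEq Δ Γ s t)
    {b B : Expr S n} (hb : T.Derivable Γ (hasType b B)) :
    T.Derivable Δ (eqTerm (b.subst s) (b.subst t) (B.subst s)) := by
  obtain ⟨-, h⟩ := subst_congr_tel hΔ hs ht hst .nil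
  have := @h b B hb
  rw [Sub.lift_zero, Sub.lift_zero] at this
  exact this

theorem IsCtxMor.comp {k n : ℕ} {Δ : Ctx S k} (hΔ : T.Valid Δ) {Γ : Ctx S n} {t : Sub S n k}
    (ht : T.IsCtxMor Δ Γ t) : ∀ {l : ℕ} {Θ : Ctx S l} {r : Sub S l n}, T.IsCtxMor Γ Θ r →
      T.IsCtxMor Δ Θ (r.comp t)
  | _, .nil, _, _ => trivial
  | _, .snoc Θ A, r, hr => by
    refine ⟨IsCtxMor.comp hΔ ht hr.1, ?_⟩
    have := derivable_subst hΔ ht hr.2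
    simp only [Judgement.subst, Expr.subst_subst] at this
    exact this

/-- Morphisms do not depend on the representatives of source and target. -/
theorem IsCtxMor.congr {k n : ℕ} {Δ Δ' : Ctx S k} {Γ Γ' : Ctx S n}
    (hΔ' : T.Valid Δ') (hΓ : T.Valid Γ) (hΓ' : T.Valid Γ') (eΔ : T.CtxEq Δ Δ') (eΓ : T.CtxEq Γ Γ')
    {t : Sub S n k} (ht : T.IsCtxMor Δ Γ t) : T.IsCtxMor Δ' Γ' t := by
  have h1 := IsCtxMor.comp hΔ' (CtxEq.isCtxMor hΔ' eΔ) ht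
  rw [Sub.comp_id] at h1
  exact IsCtxMor.comp hΔ' h1 (CtxEq.isCtxMor hΓ (CtxEq.symm hΓ' eΓ))

theorem CtxMorEq.right {k : ℕ} {Δ : Ctx S k} : ∀ {n : ℕ} {Γ : Ctx S n} {s t : Sub S n k},
    T.CtxMorEq Δ Γ s t → T.IsCtxMor Δ Γ t
  | _, .nil, _, _, _ => trivial
  | _, .snoc _ _, _, _, h => ⟨CtxMorEq.right h.1, (T.eqTerm_wf h.2).2⟩

theorem CtxMorEq.congr {k : ℕ} {Δ Δ' : Ctx S k} (hΔ : T.Valid Δ) (hΔ' : T.Valid Δ')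
    (eΔ : T.CtxEq Δ Δ') : ∀ {n : ℕ} {Γ Γ' : Ctx S n}, T.CtxEq Γ Γ' →
      ∀ {s t : Sub S n k}, T.CtxMorEq Δ Γ s t → T.CtxMorEq Δ' Γ' s t
  | _, .nil, .nil, _, _, _, _ => trivial
  | _, .snoc _ _, .snoc _ _, eΓ, _, _, h =>
    ⟨CtxMorEq.congr hΔ hΔ' eΔ eΓ.1 h.1, CtxEq.derivable hΔ' eΔ
      (T.eqTerm_conv h.2 (derivable_subst hΔ (CtxMorEq.right h.1) eΓ.2))⟩

theorem CtxMorEq.refl {k : ℕ} {Δ : Ctx S k} : ∀ {n : ℕ} {Γ : Ctx S n} {t : Sub S n k},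
    T.IsCtxMor Δ Γ t → T.CtxMorEq Δ Γ t t
  | _, .nil, _, _ => trivial
  | _, .snoc _ _, _, ht => ⟨CtxMorEq.refl ht.1, T.term_refl ht.2⟩

theorem CtxMorEq.symm {k : ℕ} {Δ : Ctx S k} (hΔ : T.Valid Δ) : ∀ {n : ℕ} {Γ : Ctx S n}
    {s t : Sub S n k}, T.Valid Γ → T.IsCtxMor Δ Γ s → T.IsCtxMor Δ Γ t →
      T.CtxMorEq Δ Γ s t → T.CtxMorEq Δ Γ t s
  | _, .nil, _, _, _, _, _, _ => trivial
  | _, .snoc _ _, _, _, hΓ, hs, ht, h =>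
    have h1 := CtxMorEq.symm hΔ hΓ.1 hs.1 ht.1 h.1
    ⟨h1, T.eqTerm_conv (T.term_symm h.2) (subst_congr_isType hΔ ht.1 hs.1 h1 hΓ.2)⟩

theorem CtxMorEq.trans {k : ℕ} {Δ : Ctx S k} (hΔ : T.Valid Δ) : ∀ {n : ℕ} {Γ : Ctx S n}
    {r s t : Sub S n k}, T.Valid Γ → T.IsCtxMor Δ Γ s → T.IsCtxMor Δ Γ t →
      T.CtxMorEq Δ Γ r s → T.CtxMorEq Δ Γ s t → T.CtxMorEq Δ Γ r t
  | _, .nil, _, _, _, _, _, _, _, _ => trivial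
  | _, .snoc _ _, _, _, _, hΓ, hs, ht, h, h' =>
    ⟨CtxMorEq.trans hΔ hΓ.1 hs.1 ht.1 h.1 h'.1, T.term_trans
      (T.eqTerm_conv h.2 (subst_congr_isType hΔ hs.1 ht.1 h'.1 hΓ.2)) h'.2⟩

/-- Composition respects definitional equality in its first argument. -/
theorem CtxMorEq.comp_left {k n : ℕ} {Δ : Ctx S k} (hΔ : T.Valid Δ) {Γ : Ctx S n}
    {s t : Sub S n k} (hs : T.IsCtxMor Δ Γ s) (ht : T.IsCtxMor Δ Γ t) (hst : T.CtxMorEq Δ Γ s t) :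
    ∀ {l : ℕ} {Θ : Ctx S l} {r : Sub S l n}, T.IsCtxMor Γ Θ r →
      T.CtxMorEq Δ Θ (r.comp s) (r.comp t)
  | _, .nil, _, _ => trivial
  | l + 1, .snoc Θ A, r, hr => by
    refine ⟨CtxMorEq.comp_left hΔ hs ht hst hr.1, ?_⟩
    have h1 := subst_congr_hasType hΔ hs ht hst hr.2
    have h2 := subst_congr_isType hΔ hs ht hst (T.hasType_wf hr.2)
    have h3 := T.eqTerm_conv h1 h2
    rw [Expr.subst_subst] at h3
    exact h3

/-- Composition respects definitional equality in its second argument. -/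
theorem CtxMorEq.comp_right {k n : ℕ} {Δ : Ctx S k} (hΔ : T.Valid Δ) {Γ : Ctx S n}
    {t : Sub S n k} (ht : T.IsCtxMor Δ Γ t) :
    ∀ {l : ℕ} {Θ : Ctx S l} {r r' : Sub S l n}, T.CtxMorEq Γ Θ r r' →
      T.CtxMorEq Δ Θ (r.comp t) (r'.comp t)
  | _, .nil, _, _, _ => trivial
  | l + 1, .snoc Θ A, r, r', hr => by
    refine ⟨CtxMorEq.comp_right hΔ ht hr.1, ?_⟩
    have := derivable_subst hΔ ht hr.2
    simp only [Judgement.subst, Expr.subst_subst] at this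
    exact this

/-- The projection `(x_0, …, x_{n-1}) : [Γ, Δ] → [Γ]`. -/
theorem isCtxMor_proj {n : ℕ} {Γ : Ctx S n} : ∀ {m : ℕ} (Δ : Tel S n m), T.Valid (Γ.append Δ) →
    T.IsCtxMor (Γ.append Δ) Γ (fun i => Expr.var (Fin.castAdd m i))
  | _, .nil, h => isCtxMor_id h
  | _, .snoc Δ _, h => IsCtxMor.wk h.2 (isCtxMor_proj Δ h.1)

theorem valid_of_append {n : ℕ} {Γ : Ctx S n} : ∀ {m : ℕ} (Δ : Tel S n m), T.Valid (Γ.append Δ) →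
    T.Valid Γ
  | _, .nil, h => h
  | _, .snoc Δ _, h => valid_of_append Δ h.1

end TypeTheory

end Admissible

/-! ### Propositional identity types -/

/-- Constructors `Id_A(a, b)`, `r(a)`, `J(a, b, p, d)` and `H(a, d)`, as operations on raw expressions
that commute with substitution. They receive all the data of the rules below as arguments (the type
`A`, the parameter context `Δ` and the type `C`), but need not make use of all of them. -/
structure IdFormers (S : Signature.{u}) where
  Id : ∀ {n : ℕ} (A a b : Expr S n), Expr S n
  r : ∀ {n : ℕ} (A a : Expr S n), Expr S n
  J : ∀ {n m : ℕ} (A : Expr S n) (Δ : Tel S (n + 3) m) (C : Expr S (n + 3 + m))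
    (d : Expr S (n + 1 + m)) (a b p : Expr S n), Expr S (n + m)
  H : ∀ {n m : ℕ} (A : Expr S n) (Δ : Tel S (n + 3) m) (C : Expr S (n + 3 + m))
    (d : Expr S (n + 1 + m)) (a : Expr S n), Expr S (n + m)
  Id_subst : ∀ {n k : ℕ} (A a b : Expr S n) (σ : Sub S n k),
    (Id A a b).subst σ = Id (A.subst σ) (a.subst σ) (b.subst σ)
  r_subst : ∀ {n k : ℕ} (A a : Expr S n) (σ : Sub S n k),
    (r A a).subst σ = r (A.subst σ) (a.subst σ)
  J_subst : ∀ {n m k : ℕ} (A : Expr S n) (Δ : Tel S (n + 3) m) (C : Expr S (n + 3 + m))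
    (d : Expr S (n + 1 + m)) (a b p : Expr S n) (σ : Sub S n k),
    (J A Δ C d a b p).subst (Sub.lift m σ) =
      J (A.subst σ) (Δ.subst (Sub.lift 3 σ)) (C.subst (Sub.lift m (Sub.lift 3 σ)))
        (d.subst (Sub.lift m (Sub.lift 1 σ))) (a.subst σ) (b.subst σ) (p.subst σ)
  H_subst : ∀ {n m k : ℕ} (A : Expr S n) (Δ : Tel S (n + 3) m) (C : Expr S (n + 3 + m))
    (d : Expr S (n + 1 + m)) (a : Expr S n) (σ : Sub S n k),
    (H A Δ C d a).subst (Sub.lift m σ) =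
      H (A.subst σ) (Δ.subst (Sub.lift 3 σ)) (C.subst (Sub.lift m (Sub.lift 3 σ)))
        (d.subst (Sub.lift m (Sub.lift 1 σ))) (a.subst σ)

/-- The substitution `[a/x, b/y, p/u]` for the last three variables `x, y, u`. -/
def Sub.inst₃ {n : ℕ} (a b p : Expr S n) : Sub S (n + 3) n :=
  (((Sub.id S n).snoc a).snoc b).snoc p

namespace IdFormers

/-- The context `[Γ, x ∈ A, y ∈ A, u ∈ Id_A(x, y)]`. -/
def idCtx (F : IdFormers S) {n : ℕ} (Γ : Ctx S n) (A : Expr S n) : Ctx S (n + 3) :=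
  ((Γ.snoc A).snoc A.wk).snoc (F.Id A.wk.wk (Expr.last S n).wk (Expr.last S (n + 1)))

/-- The substitution `[x/x, x/y, r(x)/u]` from the variables `x, y, u` to the variable `x`. -/
def diag (F : IdFormers S) {n : ℕ} (A : Expr S n) : Sub S (n + 3) (n + 1) :=
  (((Sub.wk S n).snoc (Expr.last S n)).snoc (Expr.last S n)).snoc (F.r A.wk (Expr.last S n))

end IdFormers

/-- Propositional identity types in a type theory: formation, introduction, elimination and
(propositional) computation rule, and the congruence rules for the four constructors. -/
structure PropIdTypes (T : TypeTheory S) extends IdFormers S where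
  formation : ∀ {n : ℕ} {Γ : Ctx S n} {A a b : Expr S n},
    T.Derivable Γ (hasType a A) → T.Derivable Γ (hasType b A) → T.Derivable Γ (isType (Id A a b))
  introduction : ∀ {n : ℕ} {Γ : Ctx S n} {A a : Expr S n},
    T.Derivable Γ (hasType a A) → T.Derivable Γ (hasType (r A a) (Id A a a))
  elimination : ∀ {n m : ℕ} {Γ : Ctx S n} {A : Expr S n} {Δ : Tel S (n + 3) m}
    {C : Expr S (n + 3 + m)} {d : Expr S (n + 1 + m)} {a b p : Expr S n},
    T.Derivable ((toIdFormers.idCtx Γ A).append Δ) (isType C) →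
    T.Derivable Γ (hasType a A) → T.Derivable Γ (hasType b A) →
    T.Derivable Γ (hasType p (Id A a b)) →
    T.Derivable ((Γ.snoc A).append (Δ.subst (toIdFormers.diag A)))
      (hasType d (C.subst (Sub.lift m (toIdFormers.diag A)))) →
    T.Derivable (Γ.append (Δ.subst (Sub.inst₃ a b p)))
      (hasType (J A Δ C d a b p) (C.subst (Sub.lift m (Sub.inst₃ a b p))))
  computation : ∀ {n m : ℕ} {Γ : Ctx S n} {A : Expr S n} {Δ : Tel S (n + 3) m}
    {C : Expr S (n + 3 + m)} {d : Expr S (n + 1 + m)} {a : Expr S n},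
    T.Derivable ((toIdFormers.idCtx Γ A).append Δ) (isType C) →
    T.Derivable Γ (hasType a A) →
    T.Derivable ((Γ.snoc A).append (Δ.subst (toIdFormers.diag A)))
      (hasType d (C.subst (Sub.lift m (toIdFormers.diag A)))) →
    T.Derivable (Γ.append (Δ.subst (Sub.inst₃ a a (r A a))))
      (hasType (H A Δ C d a)
        (Id (C.subst (Sub.lift m (Sub.inst₃ a a (r A a)))) (J A Δ C d a a (r A a))
          (d.subst (Sub.lift m (Sub.inst a)))))
  Id_congr : ∀ {n : ℕ} {Γ : Ctx S n} {A A' a a' b b' : Expr S n},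
    T.Derivable Γ (eqType A A') → T.Derivable Γ (eqTerm a a' A) → T.Derivable Γ (eqTerm b b' A) →
    T.Derivable Γ (eqType (Id A a b) (Id A' a' b'))
  r_congr : ∀ {n : ℕ} {Γ : Ctx S n} {A A' a a' : Expr S n},
    T.Derivable Γ (eqType A A') → T.Derivable Γ (eqTerm a a' A) →
    T.Derivable Γ (eqTerm (r A a) (r A' a') (Id A a a))
  J_congr : ∀ {n m : ℕ} {Γ : Ctx S n} {A A' : Expr S n} {Δ Δ' : Tel S (n + 3) m}
    {C C' : Expr S (n + 3 + m)} {d d' : Expr S (n + 1 + m)} {a a' b b' p p' : Expr S n},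
    T.CtxEq ((toIdFormers.idCtx Γ A).append Δ) ((toIdFormers.idCtx Γ A').append Δ') →
    T.Derivable ((toIdFormers.idCtx Γ A).append Δ) (eqType C C') →
    T.Derivable Γ (eqTerm a a' A) → T.Derivable Γ (eqTerm b b' A) →
    T.Derivable Γ (eqTerm p p' (Id A a b)) →
    T.Derivable ((Γ.snoc A).append (Δ.subst (toIdFormers.diag A)))
      (eqTerm d d' (C.subst (Sub.lift m (toIdFormers.diag A)))) →
    T.Derivable (Γ.append (Δ.subst (Sub.inst₃ a b p)))
      (eqTerm (J A Δ C d a b p) (J A' Δ' C' d' a' b' p')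
        (C.subst (Sub.lift m (Sub.inst₃ a b p))))
  H_congr : ∀ {n m : ℕ} {Γ : Ctx S n} {A A' : Expr S n} {Δ Δ' : Tel S (n + 3) m}
    {C C' : Expr S (n + 3 + m)} {d d' : Expr S (n + 1 + m)} {a a' : Expr S n},
    T.CtxEq ((toIdFormers.idCtx Γ A).append Δ) ((toIdFormers.idCtx Γ A').append Δ') →
    T.Derivable ((toIdFormers.idCtx Γ A).append Δ) (eqType C C') →
    T.Derivable Γ (eqTerm a a' A) →
    T.Derivable ((Γ.snoc A).append (Δ.subst (toIdFormers.diag A)))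
      (eqTerm d d' (C.subst (Sub.lift m (toIdFormers.diag A)))) →
    T.Derivable (Γ.append (Δ.subst (Sub.inst₃ a a (r A a))))
      (eqTerm (H A Δ C d a) (H A' Δ' C' d' a')
        (Id (C.subst (Sub.lift m (Sub.inst₃ a a (r A a)))) (J A Δ C d a a (r A a))
          (d.subst (Sub.lift m (Sub.inst a)))))

/-! ### The classifying category -/

open TypeTheory

/-- Well-formed contexts of length `n`, up to definitional equality. -/
def ctxSetoid (T : TypeTheory S) (n : ℕ) : Setoid {Γ : Ctx S n // T.Valid Γ} where
  r Γ Γ' := T.CtxEq Γ.1 Γ'.1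
  iseqv :=
    { refl := fun Γ => CtxEq.refl Γ.2
      symm := fun {_ Γ'} h => CtxEq.symm Γ'.2 h
      trans := fun {Γ Γ' _} h h' => CtxEq.trans Γ.2 Γ'.2 h h' }

/-- The objects of the classifying category: equivalence classes of well-formed contexts. -/
structure ClassifyingCategory (T : TypeTheory S) : Type u where
  len : ℕ
  cls : Quotient (ctxSetoid T len)

namespace ClassifyingCategory

variable {T : TypeTheory S}

/-- The object given by a well-formed context. -/
def of {n : ℕ} (Γ : Ctx S n) (h : T.Valid Γ) : ClassifyingCategory T :=
  ⟨n, Quotient.mk (ctxSetoid T n) ⟨Γ, h⟩⟩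

theorem ind {P : ClassifyingCategory T → Prop}
    (h : ∀ {n : ℕ} (Γ : Ctx S n) (hΓ : T.Valid Γ), P (of Γ hΓ)) (X : ClassifyingCategory T) :
    P X := by
  obtain ⟨n, q⟩ := X
  induction q using Quotient.inductionOn with
  | h Γ => exact h Γ.1 Γ.2

/-- `t` is a sequence of terms of the types of `Y` in the context `X`. -/
def IsMor (X Y : ClassifyingCategory T) (t : Sub S Y.len X.len) : Prop :=
  Quotient.lift₂ (fun Δ Γ => T.IsCtxMor Δ.1 Γ.1 t)
    (fun Δ Γ Δ' Γ' eΔ eΓ => propext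
      ⟨IsCtxMor.congr Δ'.2 Γ.2 Γ'.2 eΔ eΓ,
        IsCtxMor.congr Δ.2 Γ'.2 Γ.2 (CtxEq.symm Δ'.2 eΔ) (CtxEq.symm Γ'.2 eΓ)⟩) X.cls Y.cls

/-- Definitional equality of sequences of terms of the types of `Y` in the context `X`. -/
def MorEq (X Y : ClassifyingCategory T) (s t : {t : Sub S Y.len X.len // IsMor X Y t}) : Prop :=
  Quotient.lift₂ (fun Δ Γ => T.CtxMorEq Δ.1 Γ.1 s.1 t.1)
    (fun Δ _ Δ' Γ' eΔ eΓ => propext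
      ⟨CtxMorEq.congr Δ.2 Δ'.2 eΔ eΓ,
        CtxMorEq.congr Δ'.2 Δ.2 (CtxEq.symm Δ'.2 eΔ) (CtxEq.symm Γ'.2 eΓ)⟩) X.cls Y.cls

theorem morEq_equivalence (X Y : ClassifyingCategory T) : Equivalence (MorEq X Y) := by
  induction X using ind with
  | h Δ hΔ =>
  induction Y using ind with
  | h Γ hΓ =>
  refine ⟨fun t => ?_, fun {s t} h => ?_, fun {r s t} h h' => ?_⟩
  · exact CtxMorEq.refl t.2
  · exact CtxMorEq.symm hΔ hΓ s.2 t.2 h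
  · exact CtxMorEq.trans hΔ hΓ s.2 t.2 h h'

/-- Sequences of terms up to definitional equality. -/
def morSetoid (X Y : ClassifyingCategory T) : Setoid {t : Sub S Y.len X.len // IsMor X Y t} :=
  ⟨MorEq X Y, morEq_equivalence X Y⟩

/-- The morphisms of the classifying category. -/
def Hom (X Y : ClassifyingCategory T) : Type u := Quotient (morSetoid X Y)

theorem isMor_id (X : ClassifyingCategory T) : IsMor X X (Sub.id S X.len) := by
  induction X using ind with
  | h Γ hΓ => exact isCtxMor_id hΓ

theorem isMor_comp {X Y Z : ClassifyingCategory T} {t : Sub S Y.len X.len} {r : Sub S Z.len Y.len}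
    (ht : IsMor X Y t) (hr : IsMor Y Z r) : IsMor X Z (r.comp t) := by
  induction X using ind with
  | h Δ hΔ =>
  induction Y using ind with
  | h Γ hΓ =>
  induction Z using ind with
  | h Θ hΘ => exact IsCtxMor.comp hΔ ht hr

theorem morEq_comp {X Y Z : ClassifyingCategory T} (t t' : {t : Sub S Y.len X.len // IsMor X Y t})
    (h : MorEq X Y t t') (r r' : {r : Sub S Z.len Y.len // IsMor Y Z r}) (h' : MorEq Y Z r r') :
    MorEq X Z ⟨r.1.comp t.1, isMor_comp t.2 r.2⟩ ⟨r'.1.comp t'.1, isMor_comp t'.2 r'.2⟩ := by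
  induction X using ind with
  | h Δ hΔ =>
  induction Y using ind with
  | h Γ hΓ =>
  induction Z using ind with
  | h Θ hΘ =>
  exact CtxMorEq.trans hΔ hΘ (IsCtxMor.comp hΔ t'.2 r.2) (IsCtxMor.comp hΔ t'.2 r'.2)
    (CtxMorEq.comp_left hΔ t.2 t'.2 h r.2) (CtxMorEq.comp_right hΔ t'.2 h')

/-- The morphism given by a sequence of terms. -/
def Hom.mk {X Y : ClassifyingCategory T} (t : Sub S Y.len X.len) (ht : IsMor X Y t) : Hom X Y :=
  Quotient.mk (morSetoid X Y) ⟨t, ht⟩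

/-- Composition is substitution. -/
def Hom.comp {X Y Z : ClassifyingCategory T} (f : Hom X Y) (g : Hom Y Z) : Hom X Z :=
  Quotient.map₂ (sa := morSetoid X Y) (sb := morSetoid Y Z) (sc := morSetoid X Z)
    (fun t r => ⟨r.1.comp t.1, isMor_comp t.2 r.2⟩)
    (fun t t' h r r' h' => morEq_comp t t' h r r' h') f g

instance : Category.{u} (ClassifyingCategory T) where
  Hom := Hom
  id X := Hom.mk (Sub.id S X.len) (isMor_id X)
  comp f g := Hom.comp f g
  id_comp f := by
    induction f using Quotient.inductionOn with
    | h t => exact congrArg (Quotient.mk _) (Subtype.ext (Sub.comp_id t.1))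
  comp_id f := by
    induction f using Quotient.inductionOn with
    | h t => rfl
  assoc f g h := by
    induction f using Quotient.inductionOn with
    | h t =>
    induction g using Quotient.inductionOn with
    | h r =>
    induction h using Quotient.inductionOn with
    | h q => exact congrArg (Quotient.mk _) (Subtype.ext (Sub.comp_assoc q.1 r.1 t.1).symm)

/-- The dependent projection `[Γ, Δ] ⟶ [Γ]`, dropping the final segment `Δ` of a context. -/
def proj {n m : ℕ} (Γ : Ctx S n) (Δ : Tel S n m) (h : T.Valid (Γ.append Δ)) :
    of (Γ.append Δ) h ⟶ of Γ (valid_of_append Δ h) :=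
  Hom.mk (X := of (Γ.append Δ) h) (Y := of Γ (valid_of_append Δ h))
    (fun i => Expr.var (Fin.castAdd m i)) (isCtxMor_proj Δ h)

/-- The class of dependent projections. -/
inductive IsDependentProjection : MorphismProperty (ClassifyingCategory T)
  | proj {n m : ℕ} (Γ : Ctx S n) (Δ : Tel S n m) (h : T.Valid (Γ.append Δ)) :
      IsDependentProjection (proj Γ Δ h)

variable (T) in
/-- Fibrations are the morphisms that are isomorphic to dependent projections. -/
def fibrations : MorphismProperty (ClassifyingCategory T) :=
  (IsDependentProjection (T := T)).isoClosure

end ClassifyingCategory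

/-! ### Path categories -/

section PathCategory

variable {C : Type u} [Category.{v} C]

/-- A path object on `B`: a factorisation of the diagonal `B ⟶ B × B` as a weak equivalence `r`
followed by a fibration `st`. -/
structure PathObject (Fib W : MorphismProperty C) (B : C) where
  prod : BinaryFan B B
  isLimit : IsLimit prod
  P : C
  r : B ⟶ P
  st : P ⟶ prod.pt
  weq : W r
  fib : Fib st
  fst_fac : r ≫ st ≫ prod.fst = 𝟙 B
  snd_fac : r ≫ st ≫ prod.snd = 𝟙 B

/-- The category `C` is a path category with the class `Fib` of fibrations and the class `W` of weak
equivalences. -/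
structure IsPathCategory (Fib W : MorphismProperty C) : Prop where
  fib_of_isIso : ∀ {X Y : C} (f : X ⟶ Y), IsIso f → Fib f
  fib_comp : ∀ {X Y Z : C} (f : X ⟶ Y) (g : Y ⟶ Z), Fib f → Fib g → Fib (f ≫ g)
  exists_pullback : ∀ {X Y Z : C} (p : X ⟶ Z) (f : Y ⟶ Z), Fib p → HasPullback f p
  fib_pullback : ∀ {P X Y Z : C} {q : P ⟶ Y} {g : P ⟶ X} {f : Y ⟶ Z} {p : X ⟶ Z},
    IsPullback q g f p → Fib p → Fib q
  hasTerminal : HasTerminal C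
  fib_terminal : ∀ {X Y : C} (_ : IsTerminal Y) (f : X ⟶ Y), Fib f
  weq_of_isIso : ∀ {X Y : C} (f : X ⟶ Y), IsIso f → W f
  two_out_of_six : ∀ {X Y Z V : C} (f : X ⟶ Y) (g : Y ⟶ Z) (h : Z ⟶ V),
    W (f ≫ g) → W (g ≫ h) → W f ∧ W g ∧ W h ∧ W (f ≫ g ≫ h)
  exists_pathObject : ∀ B : C, Nonempty (PathObject Fib W B)
  exists_section : ∀ {X Y : C} (p : X ⟶ Y), Fib p → W p → ∃ s : Y ⟶ X, s ≫ p = 𝟙 Y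
  weq_pullback : ∀ {P X Y Z : C} {q : P ⟶ Y} {g : P ⟶ X} {f : Y ⟶ Z} {p : X ⟶ Z},
    IsPullback q g f p → Fib p → W p → W q

end PathCategory

end DepTT

/-!
The fibrations are the composites of display maps, the projections that drop one variable. Without
`Σ`-types a homotopy between maps into a context cannot be a single term of an identity type, so
homotopy is defined in the manner of Leibniz: `f` and `g` are homotopic if fibrations do not
distinguish them. The weak equivalences are the maps that become invertible up to homotopy, so
that the two-out-of-six property is the one of isomorphisms.

With parameters `Δ`, the elimination and computation rules say that reflexivity lifts weakly
against display maps, and the weak lifting property passes to composites of display maps.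
This gives transport along paths, and with it path objects for composites: a path for `p ≫ d` is a
path `u` for `d` together with a path for `p` from the transport along `u` of the source to the
target. With their source fixed, paths form a contractible space. Hence a section of a fibration
that inverts it up to homotopy also inverts it up to fibrewise homotopy: acyclic fibrations are the
fibrations with contractible fibres, and these have sections and are stable under pullback.
-/

namespace DepTT

section DisplayMaps

variable {C : Type u} [Category.{v} C]

/-- Finite composites of display maps, up to isomorphism. For the dependent projections that drop
one variable these are the fibrations of the classifying category. -/
inductive Fib (D : MorphismProperty C) : MorphismProperty C
  | of_isIso {X Y : C} (f : X ⟶ Y) [IsIso f] : Fib D f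
  | comp_disp {X Y Z : C} {p : X ⟶ Y} {d : Y ⟶ Z} (hp : Fib D p) (hd : D d) : Fib D (p ≫ d)

/-- The maps `f` and `g` into `E` over `B` are identified if every reflexive display map over
`E ×_B E` relates them. This is the identity type of `q`, in a form that does not mention it. -/
def Identified (D : MorphismProperty C) {X E B : C} (q : E ⟶ B) (f g : X ⟶ E) : Prop :=
  ∀ ⦃EE F : C⦄ (e₁ e₂ : EE ⟶ E) (φ : F ⟶ EE) (r : E ⟶ F), IsPullback e₁ e₂ q q → D φ →
    r ≫ φ ≫ e₁ = 𝟙 E → r ≫ φ ≫ e₂ = 𝟙 E → ∃ l : X ⟶ F, l ≫ φ ≫ e₁ = f ∧ l ≫ φ ≫ e₂ = g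

/-- The weak left lifting property against display maps: in a commutative square from `i` to a
display map there is a diagonal whose lower triangle commutes, and whose upper triangle commutes
up to identification. -/
def HasWeakLifting (D : MorphismProperty C) {U V : C} (i : U ⟶ V) : Prop :=
  ∀ ⦃E B : C⦄ (π : E ⟶ B) (c : U ⟶ E) (f : V ⟶ B), D π → c ≫ π = i ≫ f →
    ∃ j : V ⟶ E, j ≫ π = f ∧ Identified D π (i ≫ j) c

/-- A weak identity type on a display map `d : A ⟶ Γ`. Its elimination rule `weakLifting` holds
after every substitution `x` into `Γ` and in every extension `δ` of the context of the
eliminated path. -/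
structure IdentityObject (D : MorphismProperty C) {A Γ : C} (d : A ⟶ Γ) where
  AA : C
  I : C
  pr₁ : AA ⟶ A
  pr₂ : AA ⟶ A
  st : I ⟶ AA
  r : A ⟶ I
  isPullback : IsPullback pr₁ pr₂ d d
  disp : D st
  r_fst : r ≫ st ≫ pr₁ = 𝟙 A
  r_snd : r ≫ st ≫ pr₂ = 𝟙 A
  weakLifting : ∀ {X K E U : C} {x : X ⟶ Γ} {k₁ : K ⟶ X} {k₂ : K ⟶ I} {δ : E ⟶ K} {w : U ⟶ A}
    {i : U ⟶ E}, IsPullback k₁ k₂ x (st ≫ pr₁ ≫ d) → Fib D δ → IsPullback w i r (δ ≫ k₂) →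
      HasWeakLifting D i

/-- A class of display maps, in the sense of Taylor: it is closed under isomorphism and has all base
changes. -/
class IsDisplayClass (D : MorphismProperty C) : Prop extends D.RespectsIso where
  exists_pullback : ∀ {A Γ Δ : C} (d : A ⟶ Γ) (σ : Δ ⟶ Γ), D d →
    ∃ (A' : C) (d' : A' ⟶ Δ) (σ' : A' ⟶ A), IsPullback d' σ' σ d ∧ D d'

/-- A class of display maps with weak identity types. -/
class HasIdentityTypes (D : MorphismProperty C) : Prop extends IsDisplayClass D where
  exists_identityObject : ∀ {A Γ : C} (d : A ⟶ Γ), D d → Nonempty (IdentityObject D d)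

variable {D : MorphismProperty C}

namespace Fib

theorem of_disp {X Y : C} {d : X ⟶ Y} (hd : D d) : Fib D d := by
  simpa using comp_disp (of_isIso (𝟙 X)) hd

theorem comp [D.RespectsIso] {X Y Z : C} {p : X ⟶ Y} {q : Y ⟶ Z} (hp : Fib D p)
    (hq : Fib D q) : Fib D (p ≫ q) := by
  induction hq with
  | of_isIso e =>
    cases hp with
    | of_isIso p => exact of_isIso (p ≫ e)
    | comp_disp hp hd =>
      rw [Category.assoc]
      exact comp_disp hp ((D.cancel_right_of_respectsIso _ e).2 hd)
  | comp_disp _ hd ih => simpa using comp_disp (ih hp) hd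

theorem le_of_comp_left [D.RespectsIso] {Q : MorphismProperty C}
    (of_isIso : ∀ {X Y : C} (f : X ⟶ Y) [IsIso f], Q f)
    (disp_comp : ∀ {X Y Z : C} (d : X ⟶ Y) (p : Y ⟶ Z), D d → Q p → Q (d ≫ p)) : Fib D ≤ Q := by
  suffices key : ∀ {X Y : C} {p : X ⟶ Y}, Fib D p → ∀ {Z : C} (g : Y ⟶ Z),
      (∀ {W : C} (e : W ⟶ Y) [IsIso e], Q (e ≫ g)) → ∀ {W : C} (e : W ⟶ X) [IsIso e],
        Q (e ≫ p ≫ g) by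
    intro X Y p hp
    simpa using key hp (𝟙 Y) (fun e _ => of_isIso (e ≫ 𝟙 Y)) (𝟙 X)
  intro X Y p hp
  induction hp with
  | of_isIso p =>
    intro Z g hg W e _
    simpa using hg (e ≫ p)
  | @comp_disp X Y Y' p d _ hd ih =>
    intro Z g hg W e _
    have hdg : ∀ {W : C} (e : W ⟶ Y) [IsIso e], Q (e ≫ d ≫ g) := fun e _ => by
      simpa using disp_comp (e ≫ d) g ((D.cancel_left_of_respectsIso e d).2 hd)
        (by simpa using hg (𝟙 _))
    simpa using ih (d ≫ g) hdg e

end Fib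

variable [IsDisplayClass D]

instance isStableUnderBaseChange_disp : D.IsStableUnderBaseChange where
  of_isPullback {X Y Y' S f g f' g'} h hg := by
    obtain ⟨A', e, t, h', he⟩ := IsDisplayClass.exists_pullback g f hg
    rw [← IsPullback.isoIsPullback_hom_fst _ _ h.flip h']
    exact (D.cancel_left_of_respectsIso _ _).2 he

theorem Fib.exists_pullback {E B : C} {p : E ⟶ B} (hp : Fib D p) {B' : C} (f : B' ⟶ B) :
    ∃ (E' : C) (p' : E' ⟶ B') (f' : E' ⟶ E), IsPullback p' f' f p ∧ Fib D p' := by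
  induction hp generalizing B' with
  | of_isIso p => exact ⟨B', 𝟙 B', f ≫ inv p, IsPullback.of_horiz_isIso ⟨by simp⟩, .of_isIso _⟩
  | comp_disp _ hd ih =>
    obtain ⟨Z, d', f', hZ, hd'⟩ := IsDisplayClass.exists_pullback _ f hd
    obtain ⟨E', p', f'', hE', hp'⟩ := ih f'
    exact ⟨E', p' ≫ d', f'', hE'.paste_horiz hZ, hp'.comp_disp hd'⟩

theorem Fib.of_isPullback {E' E B B' : C} {p : E ⟶ B} {f : B' ⟶ B} {p' : E' ⟶ B'} {f' : E' ⟶ E}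
    (h : IsPullback p' f' f p) (hp : Fib D p) : Fib D p' := by
  obtain ⟨_, q, _, h', hq⟩ := hp.exists_pullback f
  rw [← IsPullback.isoIsPullback_hom_fst _ _ h h']
  exact (Fib.of_isIso _).comp hq

end DisplayMaps

section Lifting

variable {C : Type u} [Category.{v} C] {D : MorphismProperty C}

theorem IdentityObject.condition {A Γ : C} {d : A ⟶ Γ} (N : IdentityObject D d) :
    N.st ≫ N.pr₂ ≫ d = N.st ≫ N.pr₁ ≫ d := by
  rw [N.isPullback.w]

theorem IdentityObject.exists_path {A Γ : C} {d : A ⟶ Γ} (N : IdentityObject D d) {X : C}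
    {f g : X ⟶ A} (h : Identified D d f g) :
    ∃ l : X ⟶ N.I, l ≫ N.st ≫ N.pr₁ = f ∧ l ≫ N.st ≫ N.pr₂ = g :=
  h N.pr₁ N.pr₂ N.st N.r N.isPullback N.disp N.r_fst N.r_snd

theorem IdentityObject.hasWeakLifting_of_fib {A Γ : C} {d : A ⟶ Γ} (N : IdentityObject D d)
    {E M : C} {m : M ⟶ N.I} (hm : Fib D m) {p : E ⟶ A} {i : E ⟶ M}
    (h : IsPullback p i N.r m) : HasWeakLifting D i :=
  N.weakLifting (x := 𝟙 Γ) (k₁ := N.st ≫ N.pr₁ ≫ d) (k₂ := 𝟙 _) (δ := m)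
    (IsPullback.id_vert _) hm (by simpa using h)

theorem IdentityObject.isPullback_const {A Γ : C} {d : A ⟶ Γ} (N : IdentityObject D d)
    {e : N.I ⟶ A} (he : N.r ≫ e = 𝟙 A) {E M : C} {p : E ⟶ A} {m₁ : M ⟶ N.I} {m₂ : M ⟶ E}
    (hM : IsPullback m₁ m₂ e p) {ρ : E ⟶ M} (hρ₁ : ρ ≫ m₁ = p ≫ N.r) (hρ₂ : ρ ≫ m₂ = 𝟙 E) :
    IsPullback p ρ N.r m₁ := by
  refine IsPullback.of_bot (v₂₁ := m₂) (v₂₂ := e) (h₃₁ := p) ?_ hρ₁.symm hM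
  rw [hρ₂, he]
  exact IsPullback.id_vert p

variable [HasIdentityTypes D]

/-- Lift against the last display map first, and transport the upper map backwards along the
resulting identification before lifting against the others. The transport is itself a lifting
problem against a shorter composite. -/
theorem HasWeakLifting.exists_lift {E B : C} {π : E ⟶ B} (hπ : Fib D π) {U V : C} {i : U ⟶ V}
    (hi : HasWeakLifting D i) {c : U ⟶ E} {f : V ⟶ B} (h : c ≫ π = i ≫ f) :
    ∃ j : V ⟶ E, j ≫ π = f := by
  induction hπ generalizing U V with
  | of_isIso π => exact ⟨f ≫ inv π, by simp⟩
  | @comp_disp E A B p e hp he ih =>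
    obtain ⟨j, hj, hid⟩ := hi e (c ≫ p) f he (by simpa using h)
    obtain ⟨N⟩ := HasIdentityTypes.exists_identityObject e he
    obtain ⟨l, hl₁, hl₂⟩ := N.exists_path hid
    obtain ⟨M, m₁, m₂, hM, hm₁⟩ := hp.exists_pullback (N.st ≫ N.pr₂)
    obtain ⟨ρ, hρ₁, hρ₂⟩ := hM.exists_lift (p ≫ N.r) (𝟙 E) (by simp [N.r_snd])
    obtain ⟨τ, hτ⟩ := ih (c := 𝟙 E) (f := m₁ ≫ N.st ≫ N.pr₁)
      (N.hasWeakLifting_of_fib hm₁ (N.isPullback_const N.r_snd hM hρ₁ hρ₂))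
      (by simp [reassoc_of% hρ₁, N.r_fst])
    obtain ⟨lc, hlc, -⟩ := hM.exists_lift l c hl₂
    obtain ⟨j', hj'⟩ := ih (c := lc ≫ τ) hi (by rw [Category.assoc, hτ, reassoc_of% hlc, hl₁])
    exact ⟨j', by rw [reassoc_of% hj', hj]⟩

theorem IdentityObject.exists_lift {A Γ : C} {d : A ⟶ Γ} (N : IdentityObject D d) (hd : D d)
    {X K E H G : C} {x : X ⟶ Γ} {k₁ : K ⟶ X} {k₂ : K ⟶ N.I}
    (hK : IsPullback k₁ k₂ x (N.st ≫ N.pr₁ ≫ d)) {δ : E ⟶ K} (hδ : Fib D δ) {π : G ⟶ H}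
    (hπ : Fib D π) {f : E ⟶ H} (hc : ∀ {U : C} (w : U ⟶ A) (i : U ⟶ E), i ≫ δ ≫ k₂ = w ≫ N.r →
      ∃ c : U ⟶ G, c ≫ π = i ≫ f) : ∃ j : E ⟶ G, j ≫ π = f := by
  obtain ⟨Y, y₁, y₂, hY, -⟩ := IsDisplayClass.exists_pullback d x hd
  obtain ⟨ρ, hρ₁, hρ₂⟩ := hK.exists_lift y₁ (y₂ ≫ N.r) (by
    simp only [Category.assoc, reassoc_of% N.r_fst, hY.w])
  have hρ : IsPullback ρ y₂ k₂ N.r := by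
    refine IsPullback.of_right (h₁₂ := k₁) (v₁₃ := x) (h₂₂ := N.st ≫ N.pr₁ ≫ d) ?_ hρ₂ hK
    rw [hρ₁, reassoc_of% N.r_fst]
    exact hY
  obtain ⟨U, v, i, hU, -⟩ := hδ.exists_pullback ρ
  have hi : IsPullback (v ≫ y₂) i N.r (δ ≫ k₂) := hU.paste_horiz hρ.flip
  obtain ⟨c, hc⟩ := hc _ i hi.w.symm
  exact (N.weakLifting hK hδ hi).exists_lift hπ hc

end Lifting

section WeakLifting

variable {C : Type u} [Category.{v} C] {D : MorphismProperty C}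

theorem Identified.precomp {X Y E B : C} {q : E ⟶ B} {f g : X ⟶ E} (H : Identified D q f g)
    (k : Y ⟶ X) : Identified D q (k ≫ f) (k ≫ g) := by
  intro EE F e₁ e₂ φ r hEE hφ hr₁ hr₂
  obtain ⟨l, hl₁, hl₂⟩ := H e₁ e₂ φ r hEE hφ hr₁ hr₂
  exact ⟨k ≫ l, by simp [hl₁], by simp [hl₂]⟩

theorem Identified.comp_of_isPullback [IsDisplayClass D] {X E B E' B' : C} {q : E ⟶ B}
    {q' : E' ⟶ B'} {e : E' ⟶ E} {β : B' ⟶ B}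
    (hE : IsPullback q' e β q) (hq' : D q') {f g : X ⟶ E'} (H : Identified D q' f g) :
    Identified D q (f ≫ e) (g ≫ e) := by
  intro EE F e₁ e₂ φ r hEE hφ hr₁ hr₂
  obtain ⟨EE', p₁, p₂, hEE', -⟩ := IsDisplayClass.exists_pullback q' q' hq'
  obtain ⟨α, hα₁, hα₂⟩ := hEE.exists_lift (p₁ ≫ e) (p₂ ≫ e) (by
    simp only [Category.assoc, ← hE.w, reassoc_of% hEE'.w])
  obtain ⟨F', φ', ι, hF', hφ'⟩ := IsDisplayClass.exists_pullback φ α hφ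
  obtain ⟨Δ, hΔ₁, hΔ₂⟩ := hEE'.exists_lift (𝟙 E') (𝟙 E') rfl
  obtain ⟨r', hr', -⟩ := hF'.exists_lift Δ (e ≫ r) (hEE.hom_ext
    (by simp [hα₁, reassoc_of% hΔ₁, hr₁]) (by simp [hα₂, reassoc_of% hΔ₂, hr₂]))
  obtain ⟨l, hl₁, hl₂⟩ := H p₁ p₂ φ' r' hEE' hφ' (by rw [reassoc_of% hr', hΔ₁])
    (by rw [reassoc_of% hr', hΔ₂])
  refine ⟨l ≫ ι, ?_, ?_⟩
  · simp only [Category.assoc, ← reassoc_of% hF'.w, hα₁, reassoc_of% hl₁]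
  · simp only [Category.assoc, ← reassoc_of% hF'.w, hα₂, reassoc_of% hl₂]

theorem HasWeakLifting.of_iso {U V U' V' : C} {i : U ⟶ V} {i' : U' ⟶ V'}
    (H : HasWeakLifting D i) (eU : U' ≅ U) (eV : V' ≅ V) (h : eU.hom ≫ i = i' ≫ eV.hom) :
    HasWeakLifting D i' := by
  intro E B π c f hπ hc
  obtain ⟨j, hj, hid⟩ := H π (eU.inv ≫ c) (eV.inv ≫ f) hπ (by
    rw [Category.assoc, hc, Iso.inv_comp_eq, reassoc_of% h, Iso.hom_inv_id_assoc])
  refine ⟨eV.hom ≫ j, by rw [Category.assoc, hj, Iso.hom_inv_id_assoc], ?_⟩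
  simpa [reassoc_of% h] using hid.precomp eU.hom

end WeakLifting

section Homotopy

variable {C : Type u} [Category.{v} C] (D : MorphismProperty C)

/-- Leibniz's law in one direction: an element of a fibration over `W ×_B E` that lies over `f` can
be moved over `g`, without changing its projection to `W`. Here `f` and `g` may first be restricted
along any map `h`. -/
def Transports {X E B : C} (q : E ⟶ B) (f g : X ⟶ E) : Prop :=
  f ≫ q = g ≫ q ∧ ∀ ⦃X' W Z F : C⦄ (h : X' ⟶ X) (w : W ⟶ B) (a : Z ⟶ W) (b : Z ⟶ E) (φ : F ⟶ Z),
    IsPullback a b w q → Fib D φ → ∀ σ : X' ⟶ F, σ ≫ φ ≫ b = h ≫ f →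
      ∃ σ' : X' ⟶ F, σ' ≫ φ ≫ a = σ ≫ φ ≫ a ∧ σ' ≫ φ ≫ b = h ≫ g

/-- Fibrewise homotopy in the sense of Leibniz: fibrations do not distinguish `f` and `g`. -/
def Homotopic {X E B : C} (q : E ⟶ B) (f g : X ⟶ E) : Prop :=
  Transports D q f g ∧ Transports D q g f

variable {D}

namespace Transports

variable {X E B : C} {q : E ⟶ B} {f g : X ⟶ E}

theorem refl (q : E ⟶ B) (f : X ⟶ E) : Transports D q f f :=
  ⟨rfl, fun _ _ _ _ _ _ _ _ _ _ _ σ hσ => ⟨σ, rfl, hσ⟩⟩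

theorem trans {k : X ⟶ E} (H : Transports D q f g) (K : Transports D q g k) :
    Transports D q f k := by
  refine ⟨H.1.trans K.1, fun X' W Z F h w a b φ hZ hφ σ hσ => ?_⟩
  obtain ⟨σ', ha', hb'⟩ := H.2 h w a b φ hZ hφ σ hσ
  obtain ⟨σ'', ha'', hb''⟩ := K.2 h w a b φ hZ hφ σ' hb'
  exact ⟨σ'', ha''.trans ha', hb''⟩

theorem precomp (H : Transports D q f g) {Y : C} (k : Y ⟶ X) :
    Transports D q (k ≫ f) (k ≫ g) := by
  refine ⟨by rw [Category.assoc, H.1, Category.assoc], fun X' W Z F h w a b φ hZ hφ σ hσ => ?_⟩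
  simpa using H.2 (h ≫ k) w a b φ hZ hφ σ (by simpa using hσ)

theorem of_isPullback {E' B' : C} {q' : E' ⟶ B'} {e : E' ⟶ E} {β : B' ⟶ B}
    (hE : IsPullback q' e β q) {f g : X ⟶ E'} (hfg : f ≫ q' = g ≫ q')
    (H : Transports D q (f ≫ e) (g ≫ e)) : Transports D q' f g := by
  refine ⟨hfg, fun X' W Z F h w a b φ hZ hφ σ hσ => ?_⟩
  obtain ⟨σ', ha, hb⟩ := H.2 h (w ≫ β) a (b ≫ e) φ (hZ.paste_vert hE) hφ σ
    (by simpa using hσ =≫ e)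
  refine ⟨σ', ha, hE.hom_ext ?_ (by simpa using hb)⟩
  simp only [Category.assoc, ← hZ.w, reassoc_of% ha, ← hfg]
  simpa [hZ.w] using hσ =≫ q'

theorem exists_lift (H : Transports D q f g) {F : C} {φ : F ⟶ E} (hφ : Fib D φ) (σ : X ⟶ F)
    (hσ : σ ≫ φ = f) : ∃ σ' : X ⟶ F, σ' ≫ φ = g := by
  obtain ⟨σ', -, hσ'⟩ := H.2 (𝟙 X) (𝟙 B) q (𝟙 E) φ (IsPullback.id_vert q) hφ σ (by simpa using hσ)
  exact ⟨σ', by simpa using hσ'⟩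

theorem map [IsDisplayClass D] (H : Transports D q f g) (hq : Fib D q) {E' B' : C}
    {q' : E' ⟶ B'} (m : E ⟶ E') (β : B ⟶ B') (hm : m ≫ q' = q ≫ β) :
    Transports D q' (f ≫ m) (g ≫ m) := by
  refine ⟨by simp only [Category.assoc, hm, reassoc_of% H.1],
    fun X' W Z F h w a b φ hZ hφ σ hσ => ?_⟩
  obtain ⟨Z₀, a₀, b₀, hZ₀, -⟩ := hq.exists_pullback (h ≫ f ≫ q)
  have hσw : σ ≫ φ ≫ a ≫ w = h ≫ f ≫ q ≫ β := by
    rw [hZ.w, reassoc_of% hσ, hm]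
  obtain ⟨z, hza, hzb⟩ := hZ.exists_lift (a₀ ≫ σ ≫ φ ≫ a) (b₀ ≫ m) (by
    simp only [Category.assoc, hσw, hm, ← reassoc_of% hZ₀.w])
  obtain ⟨F₀, φ₀, z', hF₀, hφ₀⟩ := hφ.exists_pullback z
  obtain ⟨x, hxa, hxb⟩ := hZ₀.exists_lift (𝟙 X') (h ≫ f) (by simp)
  obtain ⟨σ₀, hσ₀, -⟩ := hF₀.exists_lift x σ (hZ.hom_ext
    (by simp [hza, reassoc_of% hxa]) (by simp [hzb, reassoc_of% hxb, hσ]))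
  obtain ⟨σ', ha, hb⟩ := H.2 h (h ≫ f ≫ q) a₀ b₀ φ₀ hZ₀ hφ₀ σ₀ (by rw [reassoc_of% hσ₀, hxb])
  rw [reassoc_of% hσ₀, hxa] at ha
  exact ⟨σ' ≫ z', by simp [← reassoc_of% hF₀.w, hza, reassoc_of% ha],
    by simp [← reassoc_of% hF₀.w, hzb, reassoc_of% hb]⟩

end Transports

namespace Homotopic

variable {X E B : C} {q : E ⟶ B} {f g : X ⟶ E}

theorem refl (q : E ⟶ B) (f : X ⟶ E) : Homotopic D q f f :=
  ⟨Transports.refl q f, Transports.refl q f⟩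

theorem symm (H : Homotopic D q f g) : Homotopic D q g f := ⟨H.2, H.1⟩

theorem trans {k : X ⟶ E} (H : Homotopic D q f g) (K : Homotopic D q g k) : Homotopic D q f k :=
  ⟨H.1.trans K.1, K.2.trans H.2⟩

theorem precomp (H : Homotopic D q f g) {Y : C} (k : Y ⟶ X) : Homotopic D q (k ≫ f) (k ≫ g) :=
  ⟨H.1.precomp k, H.2.precomp k⟩

theorem of_isPullback {E' B' : C} {q' : E' ⟶ B'} {e : E' ⟶ E} {β : B' ⟶ B}
    (hE : IsPullback q' e β q) {f g : X ⟶ E'} (hfg : f ≫ q' = g ≫ q')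
    (H : Homotopic D q (f ≫ e) (g ≫ e)) : Homotopic D q' f g :=
  ⟨H.1.of_isPullback hE hfg, H.2.of_isPullback hE hfg.symm⟩

variable [IsDisplayClass D]

theorem map (H : Homotopic D q f g) (hq : Fib D q) {E' B' : C} {q' : E' ⟶ B'} (m : E ⟶ E')
    (β : B ⟶ B') (hm : m ≫ q' = q ≫ β) : Homotopic D q' (f ≫ m) (g ≫ m) :=
  ⟨H.1.map hq m β hm, H.2.map hq m β hm⟩

theorem comp_base (H : Homotopic D q f g) (hq : Fib D q) {B' : C} (β : B ⟶ B') :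
    Homotopic D (q ≫ β) f g := by
  simpa using H.map hq (q' := q ≫ β) (𝟙 E) β (by simp)

end Homotopic

/-- The map `q` is a fibrewise deformation retraction: each of its fibres contracts to a point. -/
def IsFiberContractible (D : MorphismProperty C) {E B : C} (q : E ⟶ B) : Prop :=
  ∃ s : B ⟶ E, s ≫ q = 𝟙 B ∧ Homotopic D q (q ≫ s) (𝟙 E)

namespace IsFiberContractible

variable {E B : C} {q : E ⟶ B}

theorem of_isIso (q : E ⟶ B) [IsIso q] : IsFiberContractible D q :=
  ⟨inv q, by simp, by simpa using Homotopic.refl q (𝟙 E)⟩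

theorem homotopic (hq : IsFiberContractible D q) {s : B ⟶ E} (hs : s ≫ q = 𝟙 B) :
    Homotopic D q (q ≫ s) (𝟙 E) := by
  obtain ⟨t, -, H⟩ := hq
  have hst : Homotopic D q (q ≫ t) (q ≫ s) := by simpa [reassoc_of% hs] using H.precomp (q ≫ s)
  exact hst.symm.trans H

theorem of_isPullback {E' B' : C} {q' : E' ⟶ B'} {e : E' ⟶ E} {β : B' ⟶ B}
    (hE : IsPullback q' e β q) (hq : IsFiberContractible D q) : IsFiberContractible D q' := by
  obtain ⟨s, hs, H⟩ := hq
  obtain ⟨s', hs₁, hs₂⟩ := hE.exists_lift (𝟙 B') (β ≫ s) (by simp [hs])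
  refine ⟨s', hs₁, .of_isPullback hE (by simp [hs₁]) ?_⟩
  simpa [hs₂, reassoc_of% hE.w] using H.precomp e

theorem comp [IsDisplayClass D] {A : C} {p : E ⟶ A} {q : A ⟶ B}
    (hpc : IsFiberContractible D p) (hp : Fib D p) (hq : Fib D q) (hqc : IsFiberContractible D q) :
    IsFiberContractible D (p ≫ q) := by
  obtain ⟨s, hs, H⟩ := hpc
  obtain ⟨t, ht, K⟩ := hqc
  refine ⟨t ≫ s, by simp [reassoc_of% hs, ht], ?_⟩
  have contract_base : Homotopic D (p ≫ q) (p ≫ q ≫ t ≫ s) (p ≫ s) := by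
    simpa using (K.precomp p).map hq s (𝟙 B) (by simp [reassoc_of% hs])
  simpa using contract_base.trans (H.comp_base hp q)

end IsFiberContractible

end Homotopy

section Transport

variable {C : Type u} [Category.{v} C] {D : MorphismProperty C}

namespace IdentityObject

variable {A Γ : C} {d : A ⟶ Γ} (N : IdentityObject D d)

theorem fib_src [IsDisplayClass D] (hd : D d) : Fib D (N.st ≫ N.pr₁) :=
  (Fib.of_disp N.disp).comp (.of_disp (D.of_isPullback N.isPullback.flip hd))

variable [HasIdentityTypes D]

/-- Maps on a family `M` over the paths are compared at the constant paths. The family `σ` in the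
definition of `Transports` is absorbed into the parameters of path elimination. -/
theorem transports_of_refl (hd : D d) {M U E : C} {m : M ⟶ N.I} (hm : Fib D m) {u : U ⟶ A}
    {i : U ⟶ M} (hU : IsPullback u i N.r m) {q : E ⟶ Γ} {s t : M ⟶ E}
    (hs : s ≫ q = m ≫ N.st ≫ N.pr₁ ≫ d) (ht : t ≫ q = m ≫ N.st ≫ N.pr₁ ≫ d)
    (H : Transports D q (i ≫ s) (i ≫ t)) : Transports D q s t := by
  refine ⟨hs.trans ht.symm, fun X' W Z F h w a b φ hZ hφ σ hσ => ?_⟩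
  obtain ⟨K, k₁, k₂, hK, -⟩ := ((N.fib_src hd).comp (.of_disp hd)).exists_pullback w
  rw [Category.assoc] at hK
  obtain ⟨Y, y₁, y₂, hY, hy₁⟩ := hm.exists_pullback k₂
  have hYw : y₁ ≫ k₁ ≫ w = y₂ ≫ m ≫ N.st ≫ N.pr₁ ≫ d := by rw [hK.w, reassoc_of% hY.w]
  obtain ⟨zs, hzs, hzs'⟩ := hZ.exists_lift (y₁ ≫ k₁) (y₂ ≫ s) (by simp [hYw, hs])
  obtain ⟨zt, hzt, hzt'⟩ := hZ.exists_lift (y₁ ≫ k₁) (y₂ ≫ t) (by simp [hYw, ht])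
  obtain ⟨L, δ, δ', hL, hδ⟩ := hφ.exists_pullback zs
  obtain ⟨j, hj⟩ := N.exists_lift hd hK (hδ.comp hy₁) hφ (f := δ ≫ zt) (fun {U'} w' i' hi' => by
    obtain ⟨c, -, hc⟩ := hU.exists_lift w' (i' ≫ δ ≫ y₂) (by simpa [hY.w] using hi'.symm)
    obtain ⟨c', ha, hb⟩ := H.2 c w a b φ hZ hφ (i' ≫ δ') (by
      simp only [Category.assoc, ← reassoc_of% hL.w, hzs', reassoc_of% hc])
    refine ⟨c', hZ.hom_ext ?_ ?_⟩
    · simp only [Category.assoc, ha, ← reassoc_of% hL.w, hzs, hzt]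
    · simp only [Category.assoc, hb, hzt', reassoc_of% hc])
  obtain ⟨x, hx, hx'⟩ := hK.exists_lift (σ ≫ φ ≫ a) (h ≫ m) (by
    simp only [Category.assoc, hZ.w, reassoc_of% hσ, hs])
  obtain ⟨y, hy, hy'⟩ := hY.exists_lift x h hx'
  obtain ⟨z, hz, -⟩ := hL.exists_lift y σ (hZ.hom_ext
    (by simp [hzs, reassoc_of% hy, hx]) (by simp [hzs', reassoc_of% hy', hσ]))
  exact ⟨z ≫ j, by simp [reassoc_of% hj, reassoc_of% hz, hzt, reassoc_of% hy, hx],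
    by simp [reassoc_of% hj, reassoc_of% hz, hzt', reassoc_of% hy']⟩

theorem homotopic_of_refl (hd : D d) {M U E : C} {m : M ⟶ N.I} (hm : Fib D m) {u : U ⟶ A}
    {i : U ⟶ M} (hU : IsPullback u i N.r m) {q : E ⟶ Γ} {s t : M ⟶ E}
    (hs : s ≫ q = m ≫ N.st ≫ N.pr₁ ≫ d) (ht : t ≫ q = m ≫ N.st ≫ N.pr₁ ≫ d)
    (H : Homotopic D q (i ≫ s) (i ≫ t)) : Homotopic D q s t :=
  ⟨N.transports_of_refl hd hm hU hs ht H.1, N.transports_of_refl hd hm hU ht hs H.2⟩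

theorem homotopic_endpoints (hd : D d) : Homotopic D d (N.st ≫ N.pr₁) (N.st ≫ N.pr₂) := by
  refine N.homotopic_of_refl hd (.of_isIso (𝟙 _)) (u := 𝟙 A) (i := N.r)
    (IsPullback.id_horiz N.r) (by simp) (by simp [N.condition]) ?_
  rw [N.r_fst, N.r_snd]
  exact Homotopic.refl d (𝟙 A)

theorem homotopic_of_path (hd : D d) {X : C} {f g : X ⟶ A} {l : X ⟶ N.I}
    (hf : l ≫ N.st ≫ N.pr₁ = f) (hg : l ≫ N.st ≫ N.pr₂ = g) : Homotopic D d f g := by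
  subst hf hg
  exact (N.homotopic_endpoints hd).precomp l

end IdentityObject

variable [HasIdentityTypes D]

theorem Identified.homotopic {A Γ : C} {d : A ⟶ Γ} (hd : D d) {X : C} {f g : X ⟶ A}
    (h : Identified D d f g) : Homotopic D d f g := by
  obtain ⟨N⟩ := HasIdentityTypes.exists_identityObject d hd
  obtain ⟨l, hf, hg⟩ := N.exists_path h
  exact N.homotopic_of_path hd hf hg

/-- The family `F` over the possible upper sides controls the upper triangle of the lift. For `F` a
family of paths to a given map `c`, the conclusion says that `i ≫ j` is connected to `c`. -/
theorem HasWeakLifting.exists_lift_over {E B : C} {π : E ⟶ B} (hπ : Fib D π) {U V Q F : C}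
    {i : U ⟶ V} (hi : HasWeakLifting D i) {f : V ⟶ B} {a : Q ⟶ U} {b : Q ⟶ E}
    (hQ : IsPullback a b (i ≫ f) π) {φ : F ⟶ Q} (hφ : Fib D φ) {σ : U ⟶ F}
    (hσ : σ ≫ φ ≫ a = 𝟙 U) :
    ∃ j : V ⟶ E, j ≫ π = f ∧ ∃ σ' : U ⟶ F, σ' ≫ φ ≫ a = 𝟙 U ∧ σ' ≫ φ ≫ b = i ≫ j := by
  induction hπ generalizing V Q F with
  | of_isIso π =>
    refine ⟨f ≫ inv π, by simp, σ, hσ, ?_⟩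
    rw [← cancel_mono π]
    simp only [Category.assoc, ← hQ.w, reassoc_of% hσ, IsIso.inv_hom_id, Category.comp_id]
  | @comp_disp E A B p e hp he ih =>
    obtain ⟨j, hj, hid⟩ := hi e (σ ≫ φ ≫ b ≫ p) f he (by
      simp only [Category.assoc, ← hQ.w, reassoc_of% hσ])
    obtain ⟨Q₁, a₁, b₁, hQ₁, -⟩ := IsDisplayClass.exists_pullback e (i ≫ f) he
    obtain ⟨m, hm, hm'⟩ := hQ₁.exists_lift a (b ≫ p) (by simpa using hQ.w)
    have hQm : IsPullback m b b₁ p :=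
      .of_right (h₁₂ := a₁) (v₁₃ := i ≫ f) (h₂₂ := e) (by rw [hm]; exact hQ) hm' hQ₁
    obtain ⟨σ₀, ha₀, hb₀⟩ := (hid.homotopic he).2.2 (𝟙 U) (i ≫ f) a₁ b₁ (φ ≫ m) hQ₁
      (hφ.comp (hp.of_isPullback hQm)) σ (by simp [hm'])
    simp only [Category.assoc, hm, hm', hσ, Category.id_comp] at ha₀ hb₀
    obtain ⟨Q', a', b', hQ', -⟩ := hp.exists_pullback (i ≫ j)
    obtain ⟨m', hm'₁, hm'₂⟩ := hQ.exists_lift a' b' (by simp [← reassoc_of% hQ'.w, hj])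
    obtain ⟨F', φ', f', hF', hφ'⟩ := hφ.exists_pullback m'
    obtain ⟨z, hz, hz'⟩ := hQ'.exists_lift (𝟙 U) (σ₀ ≫ φ ≫ b) (by simp [hb₀])
    obtain ⟨σ₁, hσ₁, -⟩ := hF'.exists_lift z σ₀ (hQ.hom_ext
      (by simp [hm'₁, hz, ha₀]) (by simp [hm'₂, hz']))
    obtain ⟨j', hj', σ', hσ'a, hσ'b⟩ := ih hi hQ' hφ' (σ := σ₁) (by simp [reassoc_of% hσ₁, hz])
    refine ⟨j', by rw [reassoc_of% hj', hj], σ' ≫ f', ?_, ?_⟩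
    · simp only [Category.assoc, ← reassoc_of% hF'.w, hm'₁, hσ'a]
    · simp only [Category.assoc, ← reassoc_of% hF'.w, hm'₂, hσ'b]

namespace IdentityObject

variable {A Γ : C} {d : A ⟶ Γ} (N : IdentityObject D d)

/-- A family `E` over `A` admits a transport `τ` along paths in `A`; here `M` consists of the paths
with an element of `E` over their source. Along constant paths, which form the image of `ρ`, it is
connected to the identity by any reflexive family `g` over `E ×_A E`. -/
theorem exists_transport {E M EE G : C} {p : E ⟶ A} (hp : Fib D p) {m₁ : M ⟶ N.I} {m₂ : M ⟶ E}
    (hM : IsPullback m₁ m₂ (N.st ≫ N.pr₁) p) {ρ : E ⟶ M} (hρ₁ : ρ ≫ m₁ = p ≫ N.r)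
    (hρ₂ : ρ ≫ m₂ = 𝟙 E) {e₁ e₂ : EE ⟶ E} (hEE : IsPullback e₁ e₂ p p) {g : G ⟶ EE}
    (hg : Fib D g) {r : E ⟶ G} (hr : r ≫ g ≫ e₂ = 𝟙 E) :
    ∃ (τ : M ⟶ E) (l : E ⟶ G), τ ≫ p = m₁ ≫ N.st ≫ N.pr₂ ∧
      l ≫ g ≫ e₁ = ρ ≫ τ ∧ l ≫ g ≫ e₂ = 𝟙 E := by
  have hlift : HasWeakLifting D ρ :=
    N.hasWeakLifting_of_fib (hp.of_isPullback hM) (N.isPullback_const N.r_fst hM hρ₁ hρ₂)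
  have hp_end : ρ ≫ m₁ ≫ N.st ≫ N.pr₂ = p := by
    rw [reassoc_of% hρ₁, N.r_snd, Category.comp_id]
  obtain ⟨τ, hτ, l, hl₂, hl₁⟩ :=
    hlift.exists_lift_over hp (f := m₁ ≫ N.st ≫ N.pr₂) (by simpa [hp_end] using hEE.flip) hg hr
  exact ⟨τ, l, hτ, hl₁, hl₂⟩

theorem homotopic_transport (hd : D d) {E M : C} {p : E ⟶ A} (hp : Fib D p) {m₁ : M ⟶ N.I}
    {m₂ : M ⟶ E} (hM : IsPullback m₁ m₂ (N.st ≫ N.pr₁) p) {ρ : E ⟶ M} (hρ₁ : ρ ≫ m₁ = p ≫ N.r)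
    (hρ₂ : ρ ≫ m₂ = 𝟙 E) {τ : M ⟶ E} (hτ : τ ≫ p = m₁ ≫ N.st ≫ N.pr₂)
    (H : Homotopic D p (ρ ≫ τ) (𝟙 E)) : Homotopic D (p ≫ d) m₂ τ := by
  refine N.homotopic_of_refl hd (hp.of_isPullback hM) (N.isPullback_const N.r_fst hM hρ₁ hρ₂) ?_ ?_
    ?_
  · rw [← reassoc_of% hM.w]
  · rw [reassoc_of% hτ, N.condition]
  · rw [hρ₂]
    exact H.symm.comp_base hp d

end IdentityObject

end Transport

section PathObjects

variable {C : Type u} [Category.{v} C] {D : MorphismProperty C}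

namespace IdentityObject

/-- The identity type on a base change `d'` of `d`, given by the base change of its underlying
objects. -/
def baseChange {A Γ A' Γ' : C} {d : A ⟶ Γ} (N : IdentityObject D d) {d' : A' ⟶ Γ'}
    {σ' : A' ⟶ A} {σ : Γ' ⟶ Γ} (h : IsPullback d' σ' σ d) {AA I : C} {p₁ p₂ : AA ⟶ A'}
    (hAA : IsPullback p₁ p₂ d' d') {α : AA ⟶ N.AA} (hα₁ : α ≫ N.pr₁ = p₁ ≫ σ')
    (hα₂ : α ≫ N.pr₂ = p₂ ≫ σ') {s : I ⟶ AA} {ι : I ⟶ N.I} (hI : IsPullback s ι α N.st)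
    (hs : D s) (r : A' ⟶ I) (hr₁ : r ≫ s ≫ p₁ = 𝟙 A') (hr₂ : r ≫ s ≫ p₂ = 𝟙 A')
    (hr : r ≫ ι = σ' ≫ N.r) : IdentityObject D d' where
  AA := AA
  I := I
  pr₁ := p₁
  pr₂ := p₂
  st := s
  r := r
  isPullback := hAA
  disp := hs
  r_fst := hr₁
  r_snd := hr₂
  weakLifting := by
    intro X K E U x k₁ k₂ δ w i hK hδ hU
    have hα : IsPullback p₁ α σ' N.pr₁ := by
      refine IsPullback.of_bot (v₂₁ := N.pr₂) (v₂₂ := d) (h₃₁ := d) ?_ hα₁.symm N.isPullback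
      rw [hα₂, ← h.w]
      exact hAA.paste_vert h
    have hI' : IsPullback (s ≫ p₁ ≫ d') ι σ (N.st ≫ N.pr₁ ≫ d) :=
      hI.paste_horiz (hα.paste_horiz h)
    have hr' : IsPullback r σ' ι N.r := by
      refine IsPullback.of_right (h₁₂ := s ≫ p₁ ≫ d') (v₁₃ := σ) (h₂₂ := N.st ≫ N.pr₁ ≫ d)
        ?_ hr hI'
      rw [reassoc_of% hr₁, reassoc_of% N.r_fst]
      exact h
    refine N.weakLifting (hK.paste_vert hI') hδ (w := w ≫ σ') ?_
    simpa using hU.paste_horiz hr'.flip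

variable {A Γ : C} {d : A ⟶ Γ} (N : IdentityObject D d)

theorem exists_baseChange [IsDisplayClass D] {A' Γ' : C} {d' : A' ⟶ Γ'} {σ' : A' ⟶ A} {σ : Γ' ⟶ Γ}
    (h : IsPullback d' σ' σ d) (hd' : D d') :
    ∃ (N' : IdentityObject D d') (α : N'.AA ⟶ N.AA) (ι : N'.I ⟶ N.I),
      IsPullback N'.st ι α N.st ∧ α ≫ N.pr₁ = N'.pr₁ ≫ σ' ∧ α ≫ N.pr₂ = N'.pr₂ ≫ σ' ∧
        N'.r ≫ ι = σ' ≫ N.r := by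
  obtain ⟨AA, p₁, p₂, hAA, -⟩ := IsDisplayClass.exists_pullback d' d' hd'
  obtain ⟨α, hα₁, hα₂⟩ := N.isPullback.exists_lift (p₁ ≫ σ') (p₂ ≫ σ') (by
    simp only [Category.assoc, ← h.w, reassoc_of% hAA.w])
  obtain ⟨I, s, ι, hI, hs⟩ := IsDisplayClass.exists_pullback N.st α N.disp
  obtain ⟨Δ, hΔ₁, hΔ₂⟩ := hAA.exists_lift (𝟙 A') (𝟙 A') rfl
  obtain ⟨r, hr, hr'⟩ := hI.exists_lift Δ (σ' ≫ N.r) (N.isPullback.hom_ext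
    (by simp [hα₁, reassoc_of% hΔ₁, N.r_fst]) (by simp [hα₂, reassoc_of% hΔ₂, N.r_snd]))
  exact ⟨N.baseChange h hAA hα₁ hα₂ hI hs r (by rw [reassoc_of% hr, hΔ₁])
    (by rw [reassoc_of% hr, hΔ₂]) hr', α, ι, hI, hα₁, hα₂, hr'⟩

variable [HasIdentityTypes D]

theorem homotopic_of_path_r {E B : C} {e : E ⟶ B} (he : D e) (L : IdentityObject D e)
    {s t : N.I ⟶ E} (hst : s ≫ e = t ≫ e) {l : A ⟶ L.I} (hs : l ≫ L.st ≫ L.pr₁ = N.r ≫ s)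
    (ht : l ≫ L.st ≫ L.pr₂ = N.r ≫ t) : Homotopic D e s t := by
  obtain ⟨θ, hθ₁, hθ₂⟩ := L.isPullback.exists_lift s t hst
  have hr : HasWeakLifting D N.r :=
    N.hasWeakLifting_of_fib (.of_isIso (𝟙 N.I)) (IsPullback.id_horiz N.r)
  obtain ⟨j, hj⟩ := hr.exists_lift (.of_disp L.disp) (c := l) (f := θ)
    (L.isPullback.hom_ext (by simpa [hθ₁] using hs) (by simpa [hθ₂] using ht))
  exact L.homotopic_of_path he (by rw [reassoc_of% hj, hθ₁]) (by rw [reassoc_of% hj, hθ₂])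

/-- The map `v` sends a path `u` to the concatenation of the constant path with `u`. It is defined
by transporting the constant path along `u`, with its source fixed, so that it is homotopic to the
constant path; and it is the identity on constant paths. -/
theorem exists_concat_refl (hd : D d) (L : IdentityObject D N.st) :
    ∃ v : N.I ⟶ N.I, v ≫ N.st = N.st ∧
      Homotopic D (N.st ≫ N.pr₁) ((N.st ≫ N.pr₁) ≫ N.r) v ∧
      ∃ l : A ⟶ L.I, l ≫ L.st ≫ L.pr₁ = N.r ≫ v ∧ l ≫ L.st ≫ L.pr₂ = N.r := by
  have hpr : D N.pr₁ := D.of_isPullback N.isPullback.flip hd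
  have hst := Fib.of_disp N.disp
  obtain ⟨N', α, ι, hI, hα₁, hα₂, hr⟩ :=
    N.exists_baseChange N.isPullback hpr
  obtain ⟨M, m₁, m₂, hM, -⟩ := hst.exists_pullback (N'.st ≫ N'.pr₁)
  obtain ⟨ρ, hρ₁, hρ₂⟩ := hM.exists_lift (N.st ≫ N'.r) (𝟙 N.I) (by simp [N'.r_fst])
  obtain ⟨τ, l, hτ, hl₁, hl₂⟩ :=
    N'.exists_transport hst hM hρ₁ hρ₂ L.isPullback (.of_disp L.disp) L.r_snd
  have transport_homotopic :=
    N'.homotopic_transport hpr hst hM hρ₁ hρ₂ hτ (L.homotopic_of_path N.disp hl₁ hl₂)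
  obtain ⟨κ₀, hκ₁, hκ₂⟩ := N'.isPullback.exists_lift (N.st ≫ N.pr₁ ≫ N.r ≫ N.st) N.st (by
    simp [N.r_fst])
  obtain ⟨κ, hκ, hκ'⟩ := hI.exists_lift κ₀ (𝟙 N.I) (N.isPullback.hom_ext
    (by simp [hα₁, reassoc_of% hκ₁, N.r_snd]) (by simp [hα₂, reassoc_of% hκ₂]))
  obtain ⟨μ, hμ₁, hμ₂⟩ := hM.exists_lift κ (N.st ≫ N.pr₁ ≫ N.r) (by
    rw [reassoc_of% hκ, hκ₁]; simp)
  have hr_κ : N.r ≫ κ = N.r ≫ N.st ≫ N'.r := by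
    refine hI.hom_ext (N'.isPullback.hom_ext ?_ ?_) ?_
    · simp only [Category.assoc, hκ, hκ₁, N'.r_fst, reassoc_of% N.r_fst, Category.comp_id]
    · simp only [Category.assoc, hκ, hκ₂, N'.r_snd, Category.comp_id]
    · simp only [Category.assoc, hκ', hr, reassoc_of% N.r_snd, Category.comp_id]
  have hr_μ : N.r ≫ μ = N.r ≫ ρ := by
    refine hM.hom_ext ?_ ?_
    · simp only [Category.assoc, hμ₁, hρ₁, hr_κ]
    · simp only [Category.assoc, hμ₂, hρ₂, reassoc_of% N.r_fst, Category.comp_id]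
  refine ⟨μ ≫ τ, ?_, ?_, N.r ≫ l, ?_, ?_⟩
  · rw [Category.assoc, hτ, reassoc_of% hμ₁, reassoc_of% hκ, hκ₂]
  · simpa [hμ₂] using transport_homotopic.precomp μ
  · simp only [Category.assoc, hl₁, reassoc_of% hr_μ]
  · simp only [Category.assoc, hl₂, Category.comp_id]

theorem isFiberContractible_src (hd : D d) : IsFiberContractible D (N.st ≫ N.pr₁) := by
  obtain ⟨L⟩ := HasIdentityTypes.exists_identityObject N.st N.disp
  obtain ⟨v, hv, refl_homotopic_v, l, hl₁, hl₂⟩ := N.exists_concat_refl hd L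
  have v_homotopic_id : Homotopic D N.st v (𝟙 N.I) :=
    N.homotopic_of_path_r N.disp L (by simpa using hv) hl₁ (by simpa using hl₂)
  exact ⟨N.r, N.r_fst, refl_homotopic_v.trans (v_homotopic_id.comp_base (.of_disp N.disp) N.pr₁)⟩

end IdentityObject

/-- A fibrewise path object on `q : E ⟶ B`, all of whose spaces of paths with a fixed source are
contractible. -/
structure FiberPathObject (D : MorphismProperty C) {E B : C} (q : E ⟶ B) where
  EE : C
  P : C
  e₁ : EE ⟶ E
  e₂ : EE ⟶ E
  st : P ⟶ EE
  r : E ⟶ P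
  isPullback : IsPullback e₁ e₂ q q
  fib : Fib D st
  r_fst : r ≫ st ≫ e₁ = 𝟙 E
  r_snd : r ≫ st ≫ e₂ = 𝟙 E
  contractible : IsFiberContractible D (st ≫ e₁)

theorem IdentityObject.isPullback_pairs {A Γ : C} {d : A ⟶ Γ} (N : IdentityObject D d)
    {E M Y EE : C} {p : E ⟶ A} {m₁ : M ⟶ N.I} {m₂ : M ⟶ E}
    (hM : IsPullback m₁ m₂ (N.st ≫ N.pr₁) p) {y₁ : Y ⟶ M} {y₂ : Y ⟶ E}
    (hY : IsPullback y₁ y₂ (m₁ ≫ N.st ≫ N.pr₂) p) {e₁ e₂ : EE ⟶ E}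
    (hEE : IsPullback e₁ e₂ (p ≫ d) (p ≫ d)) {z : Y ⟶ EE} (hz₁ : z ≫ e₁ = y₁ ≫ m₂)
    (hz₂ : z ≫ e₂ = y₂) {ζ : EE ⟶ N.AA} (hζ₁ : ζ ≫ N.pr₁ = e₁ ≫ p)
    (hζ₂ : ζ ≫ N.pr₂ = e₂ ≫ p) : IsPullback z (y₁ ≫ m₁) ζ N.st := by
  refine IsPullback.mk' (N.isPullback.hom_ext ?_ ?_) (fun T f g h₁ h₂ => ?_) (fun T f g h => ?_)
  · simp only [Category.assoc, hζ₁, reassoc_of% hz₁, hM.w]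
  · simp only [Category.assoc, hζ₂, reassoc_of% hz₂, hY.w]
  · refine hY.hom_ext (hM.hom_ext (by simpa using h₂) ?_) ?_
    · simpa [hz₁] using h₁ =≫ e₁
    · simpa [hz₂] using h₁ =≫ e₂
  · obtain ⟨x, hx, hx'⟩ := hM.exists_lift g (f ≫ e₁) (by
      rw [← reassoc_of% h, hζ₁, Category.assoc])
    obtain ⟨x', hx₁, hx₂⟩ := hY.exists_lift x (f ≫ e₂) (by
      rw [reassoc_of% hx, ← reassoc_of% h, hζ₂, Category.assoc])
    exact ⟨x', hEE.hom_ext (by simp [hz₁, reassoc_of% hx₁, hx']) (by simp [hz₂, hx₂]),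
      by rw [reassoc_of% hx₁, hx]⟩

variable [HasIdentityTypes D]

/-- A path for `p ≫ d` is a path in `A`, together with a path in a fibre of `p` from the transport
of the source to the target. With a fixed source, the paths in `A` form a contractible space, and
over each of them so do the targets with a path in the fibre. -/
theorem FiberPathObject.nonempty_comp_disp {E A Γ : C} {p : E ⟶ A} {d : A ⟶ Γ} (hp : Fib D p)
    (hd : D d) (O : FiberPathObject D p) : Nonempty (FiberPathObject D (p ≫ d)) := by
  obtain ⟨N⟩ := HasIdentityTypes.exists_identityObject d hd
  obtain ⟨M, m₁, m₂, hM, -⟩ := hp.exists_pullback (N.st ≫ N.pr₁)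
  obtain ⟨ρ, hρ₁, hρ₂⟩ := hM.exists_lift (p ≫ N.r) (𝟙 E) (by simp [N.r_fst])
  obtain ⟨τ, l, hτ, hl₁, hl₂⟩ := N.exists_transport hp hM hρ₁ hρ₂ O.isPullback O.fib O.r_snd
  obtain ⟨Y, y₁, y₂, hY, -⟩ := hp.exists_pullback (m₁ ≫ N.st ≫ N.pr₂)
  obtain ⟨y, hy₁, hy₂⟩ := O.isPullback.exists_lift (y₁ ≫ τ) y₂ (by rw [Category.assoc, hτ, hY.w])
  have hy : IsPullback y₁ y τ O.e₁ := by
    refine IsPullback.of_bot (v₂₁ := O.e₂) (v₂₂ := p) (h₃₁ := p) ?_ hy₁.symm O.isPullback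
    rwa [hy₂, hτ]
  obtain ⟨P, k, k', hk, hk'⟩ := O.fib.exists_pullback y
  have hP : IsPullback (k ≫ y₁) k' τ (O.st ≫ O.e₁) := hk.paste_horiz hy
  obtain ⟨EE, e₁, e₂, hEE, -⟩ := (hp.comp_disp hd).exists_pullback (p ≫ d)
  obtain ⟨z, hz₁, hz₂⟩ := hEE.exists_lift (y₁ ≫ m₂) y₂ (by
    rw [← reassoc_of% hY.w, N.condition, Category.assoc, ← reassoc_of% hM.w])
  obtain ⟨ζ, hζ₁, hζ₂⟩ := N.isPullback.exists_lift (e₁ ≫ p) (e₂ ≫ p) (by simpa using hEE.w)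
  have hz := N.isPullback_pairs hM hY hEE hz₁ hz₂ hζ₁ hζ₂
  obtain ⟨ρY, hρY₁, hρY₂⟩ := hY.exists_lift ρ (𝟙 E) (by
    rw [reassoc_of% hρ₁, N.r_snd, Category.comp_id, Category.id_comp])
  obtain ⟨r, hr, -⟩ := hk.exists_lift ρY l (O.isPullback.hom_ext
    (by simp [hy₁, reassoc_of% hρY₁, hl₁]) (by simp [hy₂, hρY₂, hl₂]))
  have src_eq : (k ≫ z) ≫ e₁ = (k ≫ y₁) ≫ m₂ := by simp [hz₁]
  exact ⟨{
    EE, P, e₁, e₂, r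
    st := k ≫ z
    isPullback := hEE
    fib := hk'.comp ((Fib.of_disp N.disp).of_isPullback hz)
    r_fst := by rw [src_eq, Category.assoc, reassoc_of% hr, reassoc_of% hρY₁, hρ₂]
    r_snd := by rw [Category.assoc, hz₂, reassoc_of% hr, hρY₂]
    contractible := src_eq ▸
      ((O.contractible.of_isPullback hP).comp
        ((O.fib.comp (hp.of_isPullback O.isPullback)).of_isPullback hP)
        ((N.fib_src hd).of_isPullback hM.flip)
        ((N.isFiberContractible_src hd).of_isPullback hM.flip)) }⟩

theorem Fib.nonempty_pathObject {E B : C} {q : E ⟶ B} (hq : Fib D q) :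
    Nonempty (FiberPathObject D q) := by
  induction hq with
  | @of_isIso E B q =>
    exact ⟨{
      EE := E, P := E, e₁ := 𝟙 E, e₂ := 𝟙 E, st := 𝟙 E, r := 𝟙 E
      isPullback := IsPullback.of_horiz_isIso_mono ⟨rfl⟩
      fib := .of_isIso _
      r_fst := by simp
      r_snd := by simp
      contractible := .of_isIso _ }⟩
  | comp_disp hp hd ih =>
    obtain ⟨O⟩ := ih
    exact FiberPathObject.nonempty_comp_disp hp hd O

end PathObjects

theorem isIso_of_two_out_of_six {K : Type*} [Category* K] {X Y Z W : K} (f : X ⟶ Y) (g : Y ⟶ Z)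
    (h : Z ⟶ W) (hfg : IsIso (f ≫ g)) (hgh : IsIso (g ≫ h)) :
    IsIso f ∧ IsIso g ∧ IsIso h ∧ IsIso (f ≫ g ≫ h) := by
  have : Mono g := mono_of_mono g h
  have : IsSplitEpi g := ⟨⟨inv (f ≫ g) ≫ f, by simp⟩⟩
  have hg : IsIso g := isIso_of_mono_of_isSplitEpi g
  have hf : IsIso f := .of_isIso_comp_right f g
  have hh : IsIso h := .of_isIso_comp_left g h
  exact ⟨hf, hg, hh, inferInstance⟩

section HomotopyEquivalences

variable {C : Type u} [Category.{v} C] (D : MorphismProperty C) {t : C} (ht : IsTerminal t)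

/-- Homotopy of maps, over the terminal object. -/
def homotopyRel : HomRel C := fun _ Y f g => Homotopic D (ht.from Y) f g

/-- The weak equivalences of the path category: the maps that become invertible in the homotopy
category. -/
def homotopyEquivalences : MorphismProperty C :=
  fun _ _ f => IsIso ((Quotient.functor (homotopyRel D ht)).map f)

variable {D ht} [IsDisplayClass D]

theorem homotopyRel_congruence (h : ∀ X, Fib D (ht.from X)) : Congruence (homotopyRel D ht) where
  equivalence := ⟨fun _ => .refl _ _, .symm, .trans⟩
  comp_left f _ _ H := H.precomp f
  comp_right g H := H.map (h _) g (𝟙 t) (ht.hom_ext _ _)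

theorem homotopyEquivalences_iff (h : ∀ X, Fib D (ht.from X)) {X Y : C} (f : X ⟶ Y) :
    homotopyEquivalences D ht f ↔
      ∃ g : Y ⟶ X, homotopyRel D ht (f ≫ g) (𝟙 X) ∧ homotopyRel D ht (g ≫ f) (𝟙 Y) := by
  have := homotopyRel_congruence h
  let L := Quotient.functor (homotopyRel D ht)
  constructor
  · intro (hf : IsIso (L.map f))
    obtain ⟨g, hg⟩ := L.map_surjective (inv (L.map f))
    refine ⟨g, ?_, ?_⟩ <;> refine (Quotient.functor_map_eq_iff (homotopyRel D ht) _ _).1 ?_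
    · exact (L.map_comp f g).trans (by rw [hg, L.map_id, IsIso.hom_inv_id])
    · exact (L.map_comp g f).trans (by rw [hg, L.map_id, IsIso.inv_hom_id])
  · rintro ⟨g, hfg, hgf⟩
    refine ⟨L.map g, ?_, ?_⟩ <;> rw [← L.map_comp, ← L.map_id]
    · exact CategoryTheory.Quotient.sound _ hfg
    · exact CategoryTheory.Quotient.sound _ hgf

theorem exists_section_of_homotopyEquivalences (h : ∀ X, Fib D (ht.from X)) {E B : C} {p : E ⟶ B}
    (hp : Fib D p) (hw : homotopyEquivalences D ht p) : ∃ s : B ⟶ E, s ≫ p = 𝟙 B := by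
  obtain ⟨g, -, hg⟩ := (homotopyEquivalences_iff h p).1 hw
  exact hg.1.exists_lift hp g rfl

theorem IsFiberContractible.homotopyEquivalences (h : ∀ X, Fib D (ht.from X)) {E B : C} {p : E ⟶ B}
    (hp : Fib D p) (hc : IsFiberContractible D p) {s : B ⟶ E} (hs : s ≫ p = 𝟙 B) :
    homotopyEquivalences D ht p ∧ homotopyEquivalences D ht s := by
  have hps : homotopyRel D ht (p ≫ s) (𝟙 E) := by
    have H := (hc.homotopic hs).comp_base hp (ht.from B)
    rwa [ht.hom_ext (p ≫ ht.from B) (ht.from E)] at H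
  have hsp : homotopyRel D ht (s ≫ p) (𝟙 B) := hs ▸ .refl _ _
  exact ⟨(homotopyEquivalences_iff h p).2 ⟨s, hps, hsp⟩,
    (homotopyEquivalences_iff h s).2 ⟨p, hsp, hps⟩⟩

end HomotopyEquivalences

section PathCategory

variable {C : Type u} [Category.{v} C] {D : MorphismProperty C} {t : C} {ht : IsTerminal t}
  [HasIdentityTypes D]

/-- A homotopy over the base is obtained by transporting a constant path along the homotopy over
the terminal object. -/
theorem isFiberContractible_of_homotopyRel {E B : C} {p : E ⟶ B} (hp : Fib D p) {s : B ⟶ E}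
    (hs : s ≫ p = 𝟙 B) (H : homotopyRel D ht (p ≫ s) (𝟙 E)) : IsFiberContractible D p := by
  obtain ⟨O⟩ := hp.nonempty_pathObject
  obtain ⟨θ, hθ₁, hθ₂⟩ := O.isPullback.exists_lift (p ≫ s) (𝟙 E) (by simp [hs])
  obtain ⟨G, γ, γ', hG, hγ⟩ := O.fib.exists_pullback θ
  obtain ⟨σ, hσ, -⟩ := hG.exists_lift (p ≫ s) (p ≫ s ≫ O.r) (O.isPullback.hom_ext
    (by simp [hθ₁, reassoc_of% hs, O.r_fst]) (by simp [hθ₂, O.r_snd]))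
  obtain ⟨path, hpath⟩ := H.1.exists_lift hγ σ hσ
  have path_st : path ≫ γ' ≫ O.st = θ := by rw [← hG.w, reassoc_of% hpath]
  have endpoints := (O.contractible.homotopic (s := O.r) O.r_fst).map
    (O.fib.comp (hp.of_isPullback O.isPullback)) (q' := p) (O.st ≫ O.e₂) p
    (by simp [O.isPullback.w])
  refine ⟨s, hs, ?_⟩
  simpa [reassoc_of% path_st, hθ₁, hθ₂, O.r_snd] using endpoints.precomp (path ≫ γ')

theorem isFiberContractible_of_homotopyEquivalences (h : ∀ X, Fib D (ht.from X)) {E B : C}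
    {p : E ⟶ B} (hp : Fib D p) (hw : homotopyEquivalences D ht p) : IsFiberContractible D p := by
  obtain ⟨s, hs⟩ := exists_section_of_homotopyEquivalences h hp hw
  obtain ⟨g, hg, -⟩ := (homotopyEquivalences_iff h p).1 hw
  have section_homotopic : Homotopic D (ht.from E) (p ≫ s) (p ≫ g) := by
    simpa [reassoc_of% hs] using hg.symm.precomp (p ≫ s)
  exact isFiberContractible_of_homotopyRel hp hs (section_homotopic.trans hg)

theorem homotopyEquivalences_of_isPullback (h : ∀ X, Fib D (ht.from X)) {P X Y Z : C} {q : P ⟶ Y}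
    {g : P ⟶ X} {f : Y ⟶ Z} {p : X ⟶ Z} (hP : IsPullback q g f p) (hp : Fib D p)
    (hw : homotopyEquivalences D ht p) : homotopyEquivalences D ht q := by
  have hq := (isFiberContractible_of_homotopyEquivalences h hp hw).of_isPullback hP
  obtain ⟨s, hs, -⟩ := id hq
  exact (hq.homotopyEquivalences h (hp.of_isPullback hP) hs).1

theorem exists_pathObject (h : ∀ X, Fib D (ht.from X)) (B : C) :
    Nonempty (PathObject (Fib D) (homotopyEquivalences D ht) B) := by
  obtain ⟨O⟩ := (h B).nonempty_pathObject
  exact ⟨{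
    prod := BinaryFan.mk O.e₁ O.e₂
    isLimit := isProductOfIsTerminalIsPullback _ _ _ _ ht O.isPullback.isLimit
    P := O.P
    r := O.r
    st := O.st
    weq := (O.contractible.homotopyEquivalences h
      (O.fib.comp ((h B).of_isPullback O.isPullback)) O.r_fst).2
    fib := O.fib
    fst_fac := O.r_fst
    snd_fac := O.r_snd }⟩

theorem isPathCategory_of_hasIdentityTypes (h : ∀ X, Fib D (ht.from X)) :
    IsPathCategory (Fib D) (homotopyEquivalences D ht) where
  fib_of_isIso f _ := .of_isIso f
  fib_comp _ _ hf hg := hf.comp hg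
  exists_pullback _ f hp :=
    let ⟨_, _, _, hP, _⟩ := hp.exists_pullback f
    hP.hasPullback
  fib_pullback hP hp := hp.of_isPullback hP
  hasTerminal := ht.hasTerminal
  fib_terminal {X Y} hY f := by
    have : IsIso (ht.from Y) := isIso_of_isTerminal hY ht _
    rw [hY.hom_ext f (ht.from X ≫ inv (ht.from Y))]
    exact (h X).comp (.of_isIso _)
  weq_of_isIso f _ := (inferInstance : IsIso ((Quotient.functor (homotopyRel D ht)).map f))
  two_out_of_six f g k hfg hgk := by
    simp only [homotopyEquivalences, Functor.map_comp] at hfg hgk ⊢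
    exact isIso_of_two_out_of_six _ _ _ hfg hgk
  exists_pathObject := exists_pathObject h
  exists_section _ hp hw := exists_section_of_homotopyEquivalences h hp hw
  weq_pullback hP hp hw := homotopyEquivalences_of_isPullback h hP hp hw

end PathCategory

section Substitutions

variable {S : Signature.{u}}

theorem Expr.rename_eq_subst {n m : ℕ} (e : Expr S n) (ρ : Fin n → Fin m) :
    e.rename ρ = e.subst (fun i => Expr.var (ρ i)) := by
  have h := Expr.subst_rename e ρ (Sub.id S m)
  rwa [Expr.subst_id] at h

theorem Expr.wk_subst {n m : ℕ} (e : Expr S n) (σ : Sub S (n + 1) m) :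
    e.wk.subst σ = e.subst σ.init :=
  Expr.subst_subst _ _ _

theorem Expr.last_subst {n m : ℕ} (σ : Sub S (n + 1) m) :
    (Expr.last S n).subst σ = σ (Fin.last n) := rfl

theorem Expr.wk_subst_lift {n m : ℕ} (e : Expr S n) (σ : Sub S n m) :
    e.wk.subst (Sub.lift 1 σ) = (e.subst σ).wk := by
  rw [Expr.wk_subst, Sub.lift_one, Sub.init_snoc, Expr.wk, Expr.subst_subst]

theorem Expr.last_subst_lift {n m : ℕ} (σ : Sub S n m) :
    (Expr.last S n).subst (Sub.lift 1 σ) = Expr.last S m := by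
  rw [Expr.last_subst, Sub.lift_one, Sub.snoc_last]

theorem Sub.wk_snoc_last (n : ℕ) : (Sub.wk S n).snoc (Expr.last S n) = Sub.id S (n + 1) :=
  Sub.snoc_init (Sub.id S (n + 1))

theorem Sub.inst_comp {n m : ℕ} (a : Expr S n) (σ : Sub S n m) :
    (Sub.inst a).comp σ = σ.snoc (a.subst σ) := by
  rw [Sub.inst, Sub.snoc_comp, Sub.id_comp]

theorem Sub.lift_succ {n k : ℕ} (m : ℕ) (σ : Sub S n k) :
    Sub.lift (m + 1) σ = Sub.lift 1 (Sub.lift m σ) := by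
  rw [Sub.lift_one]
  funext i
  refine Fin.lastCases (n := n + m) ?_ (fun j => ?_) i
  · rw [Sub.snoc_last]
    exact Fin.addCases_right (Fin.last m)
  · rw [Sub.snoc_castSucc]
    refine Fin.addCases (fun a => ?_) (fun b => ?_) j
    · refine (Fin.addCases_left (n := m + 1) a).trans ?_
      simp only [Sub.comp, Sub.lift, Fin.addCases_left, Expr.rename_eq_subst, Expr.subst_subst]
      rfl
    · refine (Fin.addCases_right (n := m + 1) b.castSucc).trans ?_
      simp only [Sub.comp, Sub.lift, Fin.addCases_right]
      rfl

theorem Sub.lift_one_comp {n m k : ℕ} (t : Sub S n m) (s : Sub S (m + 1) k) :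
    (Sub.lift 1 t).comp s = (t.comp s.init).snoc (s (Fin.last m)) := by
  rw [Sub.lift_one, Sub.snoc_comp, Sub.comp_assoc, Sub.wk_comp]
  rfl

theorem Sub.lift_succ_comp_snoc {n k l : ℕ} (m : ℕ) (t : Sub S n k) (s : Sub S (k + m) l)
    (a : Expr S l) : (Sub.lift (m + 1) t).comp (s.snoc a) = ((Sub.lift m t).comp s).snoc a := by
  rw [Sub.lift_succ]
  refine (Sub.lift_one_comp _ _).trans ?_
  rw [Sub.init_snoc, Sub.snoc_last]

theorem Sub.lift_one_comp_snoc {n k l : ℕ} (t : Sub S n k) (s : Sub S k l) (a : Expr S l) :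
    (Sub.lift 1 t).comp (s.snoc a) = (t.comp s).snoc a := by
  rw [Sub.lift_one_comp, Sub.init_snoc, Sub.snoc_last]

theorem Sub.lift_three_comp {n k l : ℕ} (t : Sub S n k) (s : Sub S k l) (a b c : Expr S l) :
    (Sub.lift 3 t).comp (((s.snoc a).snoc b).snoc c) =
      (((t.comp s).snoc a).snoc b).snoc c := by
  refine (Sub.lift_succ_comp_snoc 2 _ _ _).trans (congrArg (Sub.snoc · c) ?_)
  refine (Sub.lift_succ_comp_snoc 1 _ _ _).trans (congrArg (Sub.snoc · b) ?_)
  exact Sub.lift_one_comp_snoc t s a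

end Substitutions

namespace TypeTheory

open Judgement

variable {S : Signature.{u}} {T : TypeTheory S} {k n : ℕ} {Δ : Ctx S k} {Γ : Ctx S n} {A : Expr S n}

theorem isCtxMor_snoc {t : Sub S n k} {a : Expr S k} (ht : T.IsCtxMor Δ Γ t)
    (ha : T.Derivable Δ (hasType a (A.subst t))) : T.IsCtxMor Δ (Γ.snoc A) (t.snoc a) := by
  refine ⟨?_, ?_⟩
  · rwa [Sub.init_snoc]
  · rwa [Sub.init_snoc, Sub.snoc_last]

theorem isCtxMor_snoc_wk {t : Sub S n k} {a b : Expr S k} (ht : T.IsCtxMor Δ Γ t)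
    (ha : T.Derivable Δ (hasType a (A.subst t))) (hb : T.Derivable Δ (hasType b (A.subst t))) :
    T.IsCtxMor Δ ((Γ.snoc A).snoc A.wk) ((t.snoc a).snoc b) :=
  isCtxMor_snoc (isCtxMor_snoc ht ha) (by rwa [Expr.wk_subst, Sub.init_snoc])

theorem isCtxMor_inst {a : Expr S n} (hΓ : T.Valid Γ) (ha : T.Derivable Γ (hasType a A)) :
    T.IsCtxMor Γ (Γ.snoc A) (Sub.inst a) :=
  isCtxMor_snoc (isCtxMor_id hΓ) (by rwa [Expr.subst_id])

theorem isCtxMor_wk (h : T.Valid (Γ.snoc A)) : T.IsCtxMor (Γ.snoc A) Γ (Sub.wk S n) :=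
  IsCtxMor.wk h.2 (isCtxMor_id h.1)

theorem valid_snoc_subst {t : Sub S n k} (hΔ : T.Valid Δ) (ht : T.IsCtxMor Δ Γ t)
    (h : T.Valid (Γ.snoc A)) : T.Valid (Δ.snoc (A.subst t)) :=
  ⟨hΔ, derivable_subst hΔ ht h.2⟩

theorem isCtxMor_lift_one {t : Sub S n k} (hΔ : T.Valid Δ) (ht : T.IsCtxMor Δ Γ t)
    (h : T.Valid (Γ.snoc A)) :
    T.IsCtxMor (Δ.snoc (A.subst t)) (Γ.snoc A) (Sub.lift 1 t) := by
  have h' := valid_snoc_subst hΔ ht h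
  rw [Sub.lift_one]
  refine isCtxMor_snoc (IsCtxMor.wk h'.2 ht) ?_
  have := T.var_mem h'.2
  rwa [Expr.wk, Expr.subst_subst] at this

theorem isCtxMor_lift {m : ℕ} {t : Sub S n k} (hΔ : T.Valid Δ) (ht : T.IsCtxMor Δ Γ t)
    (Θ : Tel S n m) (h : T.Valid (Γ.append Θ)) : T.Valid (Δ.append (Θ.subst t)) ∧
      T.IsCtxMor (Δ.append (Θ.subst t)) (Γ.append Θ) (Sub.lift m t) := by
  induction Θ with
  | nil =>
    rw [Sub.lift_zero]
    exact ⟨hΔ, ht⟩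
  | snoc Θ A ih =>
    obtain ⟨h₁, h₂⟩ := ih h.1
    rw [Sub.lift_succ]
    exact ⟨valid_snoc_subst h₁ h₂ h, isCtxMor_lift_one h₁ h₂ h⟩

end TypeTheory

open Judgement TypeTheory

namespace ClassifyingCategory

variable {S : Signature.{u}} {T : TypeTheory S} {k n : ℕ} {Δ : Ctx S k} {Γ : Ctx S n}
  {hΔ : T.Valid Δ} {hΓ : T.Valid Γ}

/-- The morphism between objects given by contexts that a sequence of terms defines. -/
def mor (hΔ : T.Valid Δ) (hΓ : T.Valid Γ) (t : Sub S n k) (ht : T.IsCtxMor Δ Γ t) :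
    of Δ hΔ ⟶ of Γ hΓ :=
  Hom.mk (X := of Δ hΔ) (Y := of Γ hΓ) t ht

theorem exists_mor (f : of Δ hΔ ⟶ of Γ hΓ) :
    ∃ (t : Sub S n k) (ht : T.IsCtxMor Δ Γ t), mor hΔ hΓ t ht = f :=
  let ⟨t, ht⟩ := Quotient.exists_rep f
  ⟨t.1, t.2, ht⟩

theorem mor_eq_iff {s t : Sub S n k} {hs : T.IsCtxMor Δ Γ s} {ht : T.IsCtxMor Δ Γ t} :
    mor hΔ hΓ s hs = mor hΔ hΓ t ht ↔ T.CtxMorEq Δ Γ s t :=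
  Quotient.eq (r := morSetoid (of Δ hΔ) (of Γ hΓ))

theorem mor_congr {s t : Sub S n k} {hs : T.IsCtxMor Δ Γ s} (h : s = t) :
    mor hΔ hΓ s hs = mor hΔ hΓ t (h ▸ hs) := by
  subst h; rfl

/-- The projection `[Γ, x ∈ A] ⟶ [Γ]`. -/
def wkMor {A : Expr S n} (h : T.Valid (Γ.snoc A)) : of (Γ.snoc A) h ⟶ of Γ h.1 :=
  mor h h.1 (Sub.wk S n) (isCtxMor_wk h)

theorem mor_snoc_comp_wkMor {A : Expr S n} {t : Sub S n k} {a : Expr S k} (hΔ : T.Valid Δ)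
    (h : T.Valid (Γ.snoc A)) (ht : T.IsCtxMor Δ Γ t)
    (ha : T.Derivable Δ (hasType a (A.subst t))) :
    mor hΔ h (t.snoc a) (isCtxMor_snoc ht ha) ≫ wkMor h = mor hΔ h.1 t ht :=
  mor_congr (Sub.init_snoc t a)

theorem exists_term {A : Expr S n} {t : Sub S n k} {h : T.Valid (Γ.snoc A)}
    {ht : T.IsCtxMor Δ Γ t} {f : of Δ hΔ ⟶ of (Γ.snoc A) h}
    (hf : f ≫ wkMor h = mor hΔ h.1 t ht) :
    ∃ (a : Expr S k) (ha : T.Derivable Δ (hasType a (A.subst t))),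
      f = mor hΔ h (t.snoc a) (isCtxMor_snoc ht ha) := by
  obtain ⟨s, hs, rfl⟩ := exists_mor f
  have hst : T.CtxMorEq Δ Γ s.init t := mor_eq_iff.1 hf
  have ha := T.hasType_conv hs.2 (subst_congr_isType hΔ hs.1 ht hst h.2)
  refine ⟨_, ha, mor_eq_iff.2 ⟨?_, ?_⟩⟩
  · rwa [Sub.init_snoc]
  · rw [Sub.init_snoc, Sub.snoc_last]
    exact T.term_refl ha

theorem isPullback_snoc {A : Expr S n} {t : Sub S n k} (hΔ : T.Valid Δ) (ht : T.IsCtxMor Δ Γ t)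
    (h : T.Valid (Γ.snoc A)) : IsPullback (wkMor (valid_snoc_subst hΔ ht h))
      (mor (valid_snoc_subst hΔ ht h) h (Sub.lift 1 t) (isCtxMor_lift_one hΔ ht h))
      (mor hΔ h.1 t ht) (wkMor h) := by
  refine IsPullback.mk' ?_ (fun X φ ψ h₁ h₂ => ?_) (fun X a b hab => ?_)
  · refine mor_congr (?_ : t.comp (Sub.wk S k) = (Sub.wk S n).comp (Sub.lift 1 t))
    rw [Sub.wk_comp, Sub.lift_one, Sub.init_snoc]
  · induction X using ind with
    | h Θ hΘ =>
    obtain ⟨s, hs, rfl⟩ := exists_mor φ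
    obtain ⟨s', hs', rfl⟩ := exists_mor ψ
    have h_init : T.CtxMorEq Θ Δ s.init s'.init := mor_eq_iff.1 h₁
    have h_lift : T.CtxMorEq Θ (Γ.snoc A) ((Sub.lift 1 t).comp s) ((Sub.lift 1 t).comp s') :=
      mor_eq_iff.1 h₂
    rw [Sub.lift_one_comp, Sub.lift_one_comp] at h_lift
    have h_last := h_lift.2
    rw [Sub.snoc_last, Sub.snoc_last, Sub.init_snoc, ← Expr.subst_subst] at h_last
    exact mor_eq_iff.2 ⟨h_init, h_last⟩
  · induction X using ind with
    | h Θ hΘ =>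
    obtain ⟨α, hα, rfl⟩ := exists_mor a
    have hα' : b ≫ wkMor h = mor hΘ h.1 (t.comp α) (IsCtxMor.comp hΘ hα ht) := hab.symm
    obtain ⟨c, hc, rfl⟩ := exists_term hα'
    rw [← Expr.subst_subst] at hc
    exact ⟨mor hΘ _ (α.snoc c) (isCtxMor_snoc hα hc), mor_snoc_comp_wkMor _ _ hα hc,
      mor_congr (Sub.lift_one_comp_snoc t α c)⟩

theorem isPullback_append {m : ℕ} {t : Sub S n k} (ht : T.IsCtxMor Δ Γ t) (Θ : Tel S n m)
    (h : T.Valid (Γ.append Θ)) (h' : T.Valid (Δ.append (Θ.subst t)))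
    (h'' : T.IsCtxMor (Δ.append (Θ.subst t)) (Γ.append Θ) (Sub.lift m t)) :
    IsPullback (proj Δ (Θ.subst t) h') (mor h' h (Sub.lift m t) h'') (mor hΔ hΓ t ht)
      (proj Γ Θ h) := by
  induction Θ with
  | nil =>
    rw [mor_congr (Sub.lift_zero t)]
    exact IsPullback.id_horiz _
  | snoc Θ A ih =>
    have h₁ := (isCtxMor_lift hΔ ht Θ h.1).2
    rw [mor_congr (Sub.lift_succ _ t)]
    exact (isPullback_snoc h'.1 h₁ h).paste_horiz (ih h.1 h'.1 h₁)

/-- The projections that drop one variable. -/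
inductive IsExtension : MorphismProperty (ClassifyingCategory T)
  | mk {n : ℕ} {Γ : Ctx S n} {A : Expr S n} (h : T.Valid (Γ.snoc A)) : IsExtension (wkMor h)

variable (T) in
/-- The display maps of the classifying category: the morphisms that are isomorphic, as arrows, to
a projection that drops one variable. -/
def display : MorphismProperty (ClassifyingCategory T) := (IsExtension (T := T)).isoClosure

instance respectsIso_display : (display T).RespectsIso :=
  inferInstanceAs (IsExtension.isoClosure).RespectsIso

theorem display_wkMor {A : Expr S n} (h : T.Valid (Γ.snoc A)) : display T (wkMor h) :=
  MorphismProperty.le_isoClosure _ _ (IsExtension.mk h)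

namespace display

theorem exists_isPullback {X Y : ClassifyingCategory T} {f : X ⟶ Y} (hf : display T f) :
    ∃ (n : ℕ) (Γ : Ctx S n) (A : Expr S n) (h : T.Valid (Γ.snoc A)) (g : Y ⟶ of Γ h.1)
      (g' : X ⟶ of (Γ.snoc A) h), IsPullback f g' g (wkMor h) := by
  obtain ⟨_, _, _, ⟨h⟩, ⟨i⟩⟩ := hf
  exact ⟨_, _, _, h, i.inv.right, i.inv.left, IsPullback.of_vert_isIso ⟨(Arrow.w i.inv).symm⟩⟩

theorem exists_isPullback_wkMor {X Y : ClassifyingCategory T} {f : X ⟶ Y} (hf : display T f)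
    (g : of Δ hΔ ⟶ Y) : ∃ (A : Expr S k) (h : T.Valid (Δ.snoc A)) (g' : of (Δ.snoc A) h ⟶ X),
      IsPullback (wkMor h) g' g f := by
  obtain ⟨_, _, _, h, b, b', hf'⟩ := hf.exists_isPullback
  obtain ⟨t, ht, hgt⟩ := exists_mor (g ≫ b)
  have hP := isPullback_snoc hΔ ht h
  obtain ⟨g', hg₁, hg₂⟩ := hf'.exists_lift (wkMor (valid_snoc_subst hΔ ht h) ≫ g)
    (mor (valid_snoc_subst hΔ ht h) h (Sub.lift 1 t) (isCtxMor_lift_one hΔ ht h))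
    (by rw [Category.assoc, ← hgt, hP.w])
  exact ⟨_, _, g', IsPullback.of_bot (by rwa [hg₂, ← hgt]) hg₁.symm hf'⟩

theorem exists_iso {X : ClassifyingCategory T} {f : X ⟶ of Γ hΓ} (hf : display T f) :
    ∃ (A : Expr S n) (h : T.Valid (Γ.snoc A)) (e : X ≅ of (Γ.snoc A) h), e.hom ≫ wkMor h = f := by
  obtain ⟨A, h, g', hP⟩ := hf.exists_isPullback_wkMor (𝟙 _)
  exact ⟨A, h, (IsPullback.id_vert f).isoIsPullback _ _ hP,
    IsPullback.isoIsPullback_hom_fst _ _ _ _⟩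

theorem exists_pullback {X Y Z : ClassifyingCategory T} (f : X ⟶ Y) (g : Z ⟶ Y)
    (hf : display T f) : ∃ (W : ClassifyingCategory T) (f' : W ⟶ Z) (g' : W ⟶ X),
      IsPullback f' g' g f ∧ display T f' := by
  induction Z using ind with
  | h Δ hΔ =>
  obtain ⟨A, h, g', hP⟩ := hf.exists_isPullback_wkMor g
  exact ⟨_, wkMor h, g', hP, display_wkMor h⟩

end display

instance isDisplayClass_display : IsDisplayClass (display T) where
  exists_pullback f g := display.exists_pullback f g

theorem fib_proj {m : ℕ} (Θ : Tel S n m) (h : T.Valid (Γ.append Θ)) :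
    Fib (display T) (proj Γ Θ h) := by
  induction Θ with
  | nil => exact Fib.of_isIso (𝟙 (of Γ h))
  | snoc Θ A ih => exact (Fib.of_disp (display_wkMor h)).comp (ih h.1)

theorem exists_iso_proj_of_fib {X : ClassifyingCategory T} {f : X ⟶ of Γ hΓ}
    (hf : Fib (display T) f) : ∃ (m : ℕ) (Θ : Tel S n m) (h : T.Valid (Γ.append Θ))
      (e : X ≅ of (Γ.append Θ) h), e.hom ≫ proj Γ Θ h = f := by
  let Q : MorphismProperty (ClassifyingCategory T) := fun X Y f =>
    ∀ {n : ℕ} {Γ : Ctx S n} {hΓ : T.Valid Γ} (g : Y ≅ of Γ hΓ), ∃ (m : ℕ) (Θ : Tel S n m)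
      (h : T.Valid (Γ.append Θ)) (e : X ≅ of (Γ.append Θ) h), e.hom ≫ proj Γ Θ h = f ≫ g.hom
  have hQ : Fib (display T) ≤ Q := by
    refine Fib.le_of_comp_left (fun f _ n Γ hΓ g => ?_) (fun d p hd hp n Γ hΓ g => ?_)
    · exact ⟨0, .nil, hΓ, asIso f ≪≫ g, Category.comp_id _⟩
    · obtain ⟨m, Θ, h, e, he⟩ := hp g
      obtain ⟨A, h', e', he'⟩ := (((display T).cancel_right_of_respectsIso d e.hom).2 hd).exists_iso
      refine ⟨m + 1, Θ.snoc A, h', e', ?_⟩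
      change e'.hom ≫ wkMor h' ≫ proj Γ Θ h = _
      rw [reassoc_of% he', he, Category.assoc]
  simpa using hQ _ hf (Iso.refl _)

theorem fib_display : Fib (display T) = fibrations T := by
  ext X Y f
  constructor
  · intro hf
    induction Y using ind with
    | h Γ hΓ =>
    obtain ⟨m, Θ, h, e, rfl⟩ := exists_iso_proj_of_fib hf
    exact ⟨_, _, _, IsDependentProjection.proj Γ Θ h,
      ⟨Arrow.isoMk e.symm (Iso.refl _) (by simp)⟩⟩
  · rintro ⟨_, _, _, ⟨Γ, Θ, h⟩, ⟨i⟩⟩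
    rw [Arrow.iso_w' i]
    exact (Fib.of_isIso _).comp ((fib_proj Θ h).comp (.of_isIso _))

theorem valid_nil : T.Valid Ctx.nil := trivial

/-- The empty context is terminal. -/
def isTerminalNil : IsTerminal (of Ctx.nil (valid_nil (T := T))) :=
  IsTerminal.ofUniqueHom
    (fun X => Hom.mk (Y := of Ctx.nil (valid_nil (T := T))) (fun i => i.elim0) (by
      induction X using ind with
      | h _ _ => trivial))
    (fun X f => by
      induction X using ind with
      | h Δ hΔ =>
      obtain ⟨t, ht, rfl⟩ := exists_mor f
      exact mor_eq_iff.2 trivial)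

theorem fib_from_nil (X : ClassifyingCategory T) : Fib (display T) (isTerminalNil.from X) := by
  induction X using ind with
  | h Γ hΓ =>
  induction Γ with
  | nil =>
    have := isIso_of_isTerminal isTerminalNil isTerminalNil (isTerminalNil.from (of Ctx.nil hΓ))
    exact .of_isIso _
  | snoc Γ A ih =>
    rw [isTerminalNil.hom_ext (isTerminalNil.from _) (wkMor hΓ ≫ isTerminalNil.from _)]
    exact (Fib.of_disp (display_wkMor hΓ)).comp (ih hΓ.1)

end ClassifyingCategory

section Identity

variable {S : Signature.{u}}

theorem Sub.lift_three_comp_inst₃ {n k : ℕ} (t : Sub S n k) (a b c : Expr S k) :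
    (Sub.lift 3 t).comp (Sub.inst₃ a b c) = ((t.snoc a).snoc b).snoc c := by
  rw [Sub.inst₃, Sub.lift_three_comp, Sub.comp_id]

namespace IdFormers

variable (F : IdFormers S)

/-- The telescope `[x ∈ A, y ∈ A, u ∈ Id_A(x, y)]`. -/
def idTel {n : ℕ} (A : Expr S n) : Tel S n 3 :=
  ((Tel.nil.snoc A).snoc A.wk).snoc (F.Id A.wk.wk (Expr.last S n).wk (Expr.last S (n + 1)))

theorem idTel_subst {n k : ℕ} (A : Expr S n) (ξ : Sub S n k) :
    (F.idTel A).subst ξ = F.idTel (A.subst ξ) := by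
  have id_subst : (F.Id A.wk.wk (Expr.last S n).wk (Expr.last S (n + 1))).subst (Sub.lift 2 ξ) =
      F.Id (A.subst ξ).wk.wk (Expr.last S k).wk (Expr.last S (k + 1)) := by
    rw [Sub.lift_succ, F.Id_subst, Expr.wk_subst_lift, Expr.wk_subst_lift, Expr.wk_subst_lift,
      Expr.last_subst_lift, Expr.last_subst_lift]
  change ((Tel.nil.snoc (A.subst (Sub.lift 0 ξ))).snoc (A.wk.subst (Sub.lift 1 ξ))).snoc _ = _
  rw [Sub.lift_zero, Expr.wk_subst_lift, id_subst]
  rfl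

theorem diag_comp {n k : ℕ} (A : Expr S n) (ξ : Sub S n k) :
    (F.diag A).comp (Sub.lift 1 ξ) = (Sub.lift 3 ξ).comp (F.diag (A.subst ξ)) := by
  rw [diag, diag, Sub.lift_three_comp, Sub.snoc_comp, Sub.snoc_comp, Sub.snoc_comp, F.r_subst,
    Expr.last_subst_lift, Expr.wk_subst_lift, Sub.wk_comp, Sub.lift_one, Sub.init_snoc]

end IdFormers

end Identity

namespace PropIdTypes

open Judgement TypeTheory

variable {S : Signature.{u}} {T : TypeTheory S} (I : PropIdTypes T)

section Context

variable {n : ℕ} {Γ : Ctx S n} {A : Expr S n}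

theorem valid_idCtx (h : T.Valid (Γ.snoc A)) : T.Valid (I.idCtx Γ A) := by
  have h' : T.Valid ((Γ.snoc A).snoc A.wk) := ⟨h, derivable_wk h.2 h.2⟩
  exact ⟨h', I.formation (derivable_wk (T.var_mem h.2) h'.2) (T.var_mem h'.2)⟩

theorem isCtxMor_snoc_id {k : ℕ} {Δ : Ctx S k} {t : Sub S n k} {a b p : Expr S k}
    (ht : T.IsCtxMor Δ Γ t) (ha : T.Derivable Δ (hasType a (A.subst t)))
    (hb : T.Derivable Δ (hasType b (A.subst t)))
    (hp : T.Derivable Δ (hasType p (I.Id (A.subst t) a b))) :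
    T.IsCtxMor Δ (I.idCtx Γ A) (((t.snoc a).snoc b).snoc p) := by
  refine isCtxMor_snoc (isCtxMor_snoc_wk ht ha hb) ?_
  simpa only [I.Id_subst, Expr.wk_subst, Sub.init_snoc, Expr.last_subst, Sub.snoc_last] using hp

theorem isCtxMor_diag (h : T.Valid (Γ.snoc A)) :
    T.IsCtxMor (Γ.snoc A) (I.idCtx Γ A) (I.diag A) :=
  have hx := T.var_mem h.2
  I.isCtxMor_snoc_id (isCtxMor_wk h) hx hx (I.introduction hx)

theorem isCtxMor_lift_three {k : ℕ} {Ξ : Ctx S k} {ξ : Sub S n k} (hΞ : T.Valid Ξ)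
    (hξ : T.IsCtxMor Ξ Γ ξ) (h : T.Valid (Γ.snoc A)) :
    T.IsCtxMor (I.idCtx Ξ (A.subst ξ)) (I.idCtx Γ A) (Sub.lift 3 ξ) := by
  have := (isCtxMor_lift hΞ hξ (I.idTel A) (I.valid_idCtx h)).2
  rwa [I.idTel_subst] at this

end Context

section Elimination

/-- The result of the elimination rule for the terms `x`, `y` and `u` given by `σ`. -/
def elim {k n m : ℕ} (A : Expr S n) (Δ : Tel S (n + 3) m) (C : Expr S (n + 3 + m))
    (d : Expr S (n + 1 + m)) (σ : Sub S (n + 3) k) : Expr S (k + m) :=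
  I.J (A.subst σ.init.init.init) (Δ.subst (Sub.lift 3 σ.init.init.init))
    (C.subst (Sub.lift m (Sub.lift 3 σ.init.init.init)))
    (d.subst (Sub.lift m (Sub.lift 1 σ.init.init.init)))
    (σ.init.init (Fin.last n)) (σ.init (Fin.last (n + 1))) (σ (Fin.last (n + 2)))

theorem elim_subst {k l n m : ℕ} (A : Expr S n) (Δ : Tel S (n + 3) m) (C : Expr S (n + 3 + m))
    (d : Expr S (n + 1 + m)) (σ : Sub S (n + 3) k) (τ : Sub S k l) :
    (I.elim A Δ C d σ).subst (Sub.lift m τ) = I.elim A Δ C d (σ.comp τ) := by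
  simp only [elim, I.J_subst, Expr.subst_subst, Tel.subst_subst, Sub.lift_comp]
  rfl

theorem elim_snoc {k n m : ℕ} (A : Expr S n) (Δ : Tel S (n + 3) m) (C : Expr S (n + 3 + m))
    (d : Expr S (n + 1 + m)) (t : Sub S n k) (a b p : Expr S k) :
    I.elim A Δ C d (((t.snoc a).snoc b).snoc p) =
      I.J (A.subst t) (Δ.subst (Sub.lift 3 t)) (C.subst (Sub.lift m (Sub.lift 3 t)))
        (d.subst (Sub.lift m (Sub.lift 1 t))) a b p := by
  simp only [elim, Sub.init_snoc, Sub.snoc_last]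

variable {n m : ℕ} {Γ : Ctx S n} {A : Expr S n} {Δ : Tel S (n + 3) m} {C : Expr S (n + 3 + m)}
  {d : Expr S (n + 1 + m)}

theorem derivable_base_subst {k : ℕ} {Ξ : Ctx S k} {ξ : Sub S n k} (hΞ : T.Valid Ξ)
    (h : T.Valid (Γ.snoc A)) (hξ : T.IsCtxMor Ξ Γ ξ)
    (hd : T.Derivable ((Γ.snoc A).append (Δ.subst (I.diag A)))
      (hasType d (C.subst (Sub.lift m (I.diag A))))) :
    T.Derivable ((Ξ.snoc (A.subst ξ)).append ((Δ.subst (Sub.lift 3 ξ)).subst (I.diag (A.subst ξ))))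
      (hasType (d.subst (Sub.lift m (Sub.lift 1 ξ)))
        ((C.subst (Sub.lift m (Sub.lift 3 ξ))).subst (Sub.lift m (I.diag (A.subst ξ))))) := by
  have := derivable_subst_tel (valid_snoc_subst hΞ hξ h) (isCtxMor_lift_one hΞ hξ h) _ hd
  simp only [Judgement.subst, Tel.subst_subst, Expr.subst_subst, Sub.lift_comp, I.diag_comp] at this
  simpa only [Tel.subst_subst, Expr.subst_subst, Sub.lift_comp] using this

theorem hasType_elim {k : ℕ} {Ξ : Ctx S k} {σ : Sub S (n + 3) k} (hΞ : T.Valid Ξ)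
    (h : T.Valid (Γ.snoc A)) (hσ : T.IsCtxMor Ξ (I.idCtx Γ A) σ)
    (hC : T.Derivable ((I.idCtx Γ A).append Δ) (isType C))
    (hd : T.Derivable ((Γ.snoc A).append (Δ.subst (I.diag A)))
      (hasType d (C.subst (Sub.lift m (I.diag A))))) :
    T.Derivable (Ξ.append (Δ.subst σ)) (hasType (I.elim A Δ C d σ) (C.subst (Sub.lift m σ))) := by
  obtain ⟨⟨⟨hξ, hx⟩, hy⟩, hu⟩ := hσ
  rw [Expr.wk_subst] at hy
  rw [I.Id_subst, Expr.wk_subst, Expr.wk_subst, Expr.wk_subst, Expr.last_subst,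
    Expr.last_subst] at hu
  have := I.elimination (derivable_subst_tel (valid_idCtx I (valid_snoc_subst hΞ hξ h))
    (I.isCtxMor_lift_three hΞ hξ h) _ hC) hx hy hu (I.derivable_base_subst hΞ h hξ hd)
  rwa [Tel.subst_subst, Expr.subst_subst, Sub.lift_comp, Sub.lift_three_comp_inst₃, Sub.snoc_init,
    Sub.snoc_init, Sub.snoc_init] at this

theorem exists_computation (h : T.Valid (Γ.snoc A))
    (hC : T.Derivable ((I.idCtx Γ A).append Δ) (isType C))
    (hd : T.Derivable ((Γ.snoc A).append (Δ.subst (I.diag A)))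
      (hasType d (C.subst (Sub.lift m (I.diag A))))) :
    ∃ p, T.Derivable ((Γ.snoc A).append (Δ.subst (I.diag A)))
      (hasType p (I.Id (C.subst (Sub.lift m (I.diag A))) (I.elim A Δ C d (I.diag A)) d)) := by
  have hw := isCtxMor_wk h
  have := I.computation (derivable_subst_tel (valid_idCtx I (valid_snoc_subst h hw h))
    (I.isCtxMor_lift_three h hw h) _ hC) (T.var_mem h.2) (I.derivable_base_subst h h hw hd)
  simp only [Tel.subst_subst, Expr.subst_subst, Sub.lift_comp, Sub.lift_one_inst, Sub.wk_snoc_last,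
    Sub.lift_id, Expr.subst_id] at this
  rw [← I.elim_snoc, Sub.lift_three_comp_inst₃] at this
  exact ⟨_, this⟩

theorem exists_elim (h : T.Valid (Γ.snoc A)) (hC : T.Derivable ((I.idCtx Γ A).append Δ) (isType C))
    (hd : T.Derivable ((Γ.snoc A).append (Δ.subst (I.diag A)))
      (hasType d (C.subst (Sub.lift m (I.diag A))))) :
    ∃ j p, T.Derivable ((I.idCtx Γ A).append Δ) (hasType j C) ∧
      T.Derivable ((Γ.snoc A).append (Δ.subst (I.diag A))) (hasType p
        (I.Id (C.subst (Sub.lift m (I.diag A))) (j.subst (Sub.lift m (I.diag A))) d)) := by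
  obtain ⟨p, hp⟩ := I.exists_computation h hC hd
  have hj := I.hasType_elim (I.valid_idCtx h) h (isCtxMor_id (I.valid_idCtx h)) hC hd
  rw [Tel.subst_id, Sub.lift_id, Expr.subst_id] at hj
  exact ⟨_, p, hj, by rwa [I.elim_subst, Sub.id_comp]⟩

theorem exists_term_of_id {k : ℕ} {Ξ : Ctx S k} {t : Sub S n k} {a b p : Expr S k}
    {G : Expr S (n + 2)} {g : Expr S (n + 1)} (hΞ : T.Valid Ξ) (h : T.Valid (Γ.snoc A))
    (ht : T.IsCtxMor Ξ Γ t) (ha : T.Derivable Ξ (hasType a (A.subst t)))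
    (hb : T.Derivable Ξ (hasType b (A.subst t)))
    (hp : T.Derivable Ξ (hasType p (I.Id (A.subst t) a b)))
    (hG : T.Derivable ((Γ.snoc A).snoc A.wk) (isType G))
    (hg : T.Derivable (Γ.snoc A)
      (hasType g (G.subst (((Sub.wk S n).snoc (Expr.last S n)).snoc (Expr.last S n))))) :
    ∃ q, T.Derivable Ξ (hasType q (G.subst ((t.snoc a).snoc b))) := by
  have := I.hasType_elim (Δ := .nil) (C := G.wk) (d := g) hΞ h
    (I.isCtxMor_snoc_id ht ha hb hp) (derivable_wk hG (I.valid_idCtx h).2) (by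
      rwa [Sub.lift_zero, Expr.wk_subst, IdFormers.diag, Sub.init_snoc])
  rw [Sub.lift_zero, Expr.wk_subst, Sub.init_snoc] at this
  exact ⟨_, this⟩

end Elimination

end PropIdTypes

open Judgement TypeTheory

namespace ClassifyingCategory

variable {S : Signature.{u}} {T : TypeTheory S}

section WeakLifting

variable {k n : ℕ} {Δ : Ctx S k} {Γ : Ctx S n}

theorem valid_snoc_wk {A : Expr S n} (h : T.Valid (Γ.snoc A)) : T.Valid ((Γ.snoc A).snoc A.wk) :=
  valid_snoc_subst h (isCtxMor_wk h) h

theorem isPullback_snoc_wk {A : Expr S n} (h : T.Valid (Γ.snoc A)) :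
    IsPullback (wkMor (valid_snoc_wk h)) (mor (valid_snoc_wk h) h (Sub.lift 1 (Sub.wk S n))
      (isCtxMor_lift_one h (isCtxMor_wk h) h)) (wkMor h) (wkMor h) :=
  isPullback_snoc h (isCtxMor_wk h) h

theorem mor_snoc_wk_comp_fst {A : Expr S n} {t : Sub S n k} {a b : Expr S k} (hΔ : T.Valid Δ)
    (h : T.Valid (Γ.snoc A)) (h' : T.Valid ((Γ.snoc A).snoc A.wk)) (ht : T.IsCtxMor Δ Γ t)
    (ha : T.Derivable Δ (hasType a (A.subst t))) (hb : T.Derivable Δ (hasType b (A.subst t))) :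
    mor hΔ h' ((t.snoc a).snoc b) (isCtxMor_snoc_wk ht ha hb) ≫ wkMor h' =
      mor hΔ h (t.snoc a) (isCtxMor_snoc ht ha) :=
  mor_congr (Sub.init_snoc (t.snoc a) b)

theorem mor_snoc_wk_comp_snd {A : Expr S n} {t : Sub S n k} {a b : Expr S k} (hΔ : T.Valid Δ)
    (h : T.Valid (Γ.snoc A)) (h' : T.Valid ((Γ.snoc A).snoc A.wk)) (ht : T.IsCtxMor Δ Γ t)
    (ha : T.Derivable Δ (hasType a (A.subst t))) (hb : T.Derivable Δ (hasType b (A.subst t))) :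
    mor hΔ h' ((t.snoc a).snoc b) (isCtxMor_snoc_wk ht ha hb) ≫
        mor h' h (Sub.lift 1 (Sub.wk S n)) (isCtxMor_lift_one h (isCtxMor_wk h) h) =
      mor hΔ h (t.snoc b) (isCtxMor_snoc ht hb) :=
  mor_congr ((Sub.lift_one_comp_snoc _ _ _).trans (by rw [Sub.wk_comp, Sub.init_snoc]))

theorem identified_of_id (I : PropIdTypes T) {A : Expr S n} {t : Sub S n k} {a b p : Expr S k}
    (hΔ : T.Valid Δ) (h : T.Valid (Γ.snoc A)) (ht : T.IsCtxMor Δ Γ t)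
    (ha : T.Derivable Δ (hasType a (A.subst t))) (hb : T.Derivable Δ (hasType b (A.subst t)))
    (hp : T.Derivable Δ (hasType p (I.Id (A.subst t) a b))) :
    Identified (display T) (wkMor h) (mor hΔ h (t.snoc a) (isCtxMor_snoc ht ha))
      (mor hΔ h (t.snoc b) (isCtxMor_snoc ht hb)) := by
  intro EE F e₁ e₂ φ r hEE hφ hr₁ hr₂
  have hx := T.var_mem h.2
  have h' := valid_snoc_wk h
  have hP := isPullback_snoc_wk h
  let ε := hEE.isoIsPullback _ _ hP
  have hε₁ : ε.hom ≫ wkMor h' = e₁ := IsPullback.isoIsPullback_hom_fst _ _ _ _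
  have hε₂ : ε.hom ≫ mor h' h (Sub.lift 1 (Sub.wk S n)) (isCtxMor_lift_one h (isCtxMor_wk h) h) =
    e₂ := IsPullback.isoIsPullback_hom_snd _ _ _ _
  obtain ⟨G, hG, e, he⟩ := (((display T).cancel_right_of_respectsIso φ ε.hom).2 hφ).exists_iso
  have var_eq_id : mor h h _ (isCtxMor_snoc (isCtxMor_wk h) hx) = 𝟙 _ :=
    mor_congr (Sub.wk_snoc_last n)
  have hr : (r ≫ e.hom) ≫ wkMor hG = mor h h' _ (isCtxMor_snoc_wk (isCtxMor_wk h) hx hx) := by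
    rw [Category.assoc, he]
    refine hP.hom_ext ?_ ?_
    · rw [mor_snoc_wk_comp_fst h h h' (isCtxMor_wk h) hx hx, var_eq_id, Category.assoc,
        Category.assoc, hε₁, hr₁]
    · rw [mor_snoc_wk_comp_snd h h h' (isCtxMor_wk h) hx hx, var_eq_id, Category.assoc,
        Category.assoc, hε₂, hr₂]
  obtain ⟨g, hg, -⟩ := exists_term hr
  obtain ⟨q, hq⟩ := I.exists_term_of_id hΔ h ht ha hb hp hG.2 hg
  have hq' := mor_snoc_comp_wkMor hΔ hG (isCtxMor_snoc_wk ht ha hb) hq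
  have he' : e.inv ≫ φ = wkMor hG ≫ ε.inv := by
    rw [Iso.inv_comp_eq, reassoc_of% he, Iso.hom_inv_id, Category.comp_id]
  refine ⟨mor hΔ hG _ (isCtxMor_snoc (isCtxMor_snoc_wk ht ha hb) hq) ≫ e.inv, ?_, ?_⟩
  · rw [Category.assoc, reassoc_of% he', reassoc_of% hq', ← hε₁, Iso.inv_hom_id_assoc,
      mor_snoc_wk_comp_fst hΔ h h' ht ha hb]
  · rw [Category.assoc, reassoc_of% he', reassoc_of% hq', ← hε₂, Iso.inv_hom_id_assoc,
      mor_snoc_wk_comp_snd hΔ h h' ht ha hb]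

theorem hasWeakLifting_of_forall_wkMor {hΓ : T.Valid Γ} {U : ClassifyingCategory T}
    {i : U ⟶ of Γ hΓ} (H : ∀ {C : Expr S n} (h : T.Valid (Γ.snoc C)) (c : U ⟶ of (Γ.snoc C) h),
      c ≫ wkMor h = i → ∃ j : of Γ hΓ ⟶ of (Γ.snoc C) h,
        j ≫ wkMor h = 𝟙 _ ∧ Identified (display T) (wkMor h) (i ≫ j) c) :
    HasWeakLifting (display T) i := by
  intro E B π c f hπ hc
  obtain ⟨C, h, g, hP⟩ := hπ.exists_isPullback_wkMor f
  obtain ⟨c', hc₁, hc₂⟩ := hP.exists_lift i c hc.symm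
  obtain ⟨j, hj, hid⟩ := H h c' hc₁
  refine ⟨j ≫ g, by rw [Category.assoc, ← hP.w, reassoc_of% hj], ?_⟩
  simpa [hc₂] using hid.comp_of_isPullback hP (display_wkMor h)

end WeakLifting

theorem hasWeakLifting_lift_diag (I : PropIdTypes T) {n m : ℕ} {Γ : Ctx S n} {A : Expr S n}
    (Δ : Tel S (n + 3) m) (h : T.Valid (Γ.snoc A)) (hV : T.Valid ((I.idCtx Γ A).append Δ))
    (hU : T.Valid ((Γ.snoc A).append (Δ.subst (I.diag A))))
    (hi : T.IsCtxMor ((Γ.snoc A).append (Δ.subst (I.diag A))) ((I.idCtx Γ A).append Δ)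
      (Sub.lift m (I.diag A))) :
    HasWeakLifting (display T) (mor hU hV (Sub.lift m (I.diag A)) hi) := by
  refine hasWeakLifting_of_forall_wkMor fun {C} hC c hc => ?_
  obtain ⟨d, hd, rfl⟩ := exists_term hc
  obtain ⟨j, p, hj, hp⟩ := I.exists_elim h hC.2 hd
  refine ⟨mor hV hC (Sub.inst j) (isCtxMor_inst hV hj), mor_congr (Sub.init_snoc _ j), ?_⟩
  have hj' := derivable_subst hU hi hj
  have : mor hU hV _ hi ≫ mor hV hC (Sub.inst j) (isCtxMor_inst hV hj) =
      mor hU hC _ (isCtxMor_snoc hi hj') := mor_congr (Sub.inst_comp j _)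
  rw [this]
  exact identified_of_id I hU hC hi hj' hd hp

section IdentityContext

variable (I : PropIdTypes T) {k n : ℕ} {Ξ : Ctx S k} {Γ : Ctx S n} {A : Expr S n} {ξ : Sub S n k}

/-- The projection `[Γ, x ∈ A, y ∈ A, u ∈ Id_A(x, y)] ⟶ [Γ]`. -/
def idProj (h : T.Valid (Γ.snoc A)) : of (I.idCtx Γ A) (I.valid_idCtx h) ⟶ of Γ h.1 :=
  wkMor (I.valid_idCtx h) ≫ wkMor (valid_snoc_wk h) ≫ wkMor h

/-- The morphism `[Γ, x ∈ A] ⟶ [Γ, x ∈ A, y ∈ A, u ∈ Id_A(x, y)]` given by `(x, x, r(x))`. -/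
def diagMor (h : T.Valid (Γ.snoc A)) : of (Γ.snoc A) h ⟶ of (I.idCtx Γ A) (I.valid_idCtx h) :=
  mor h (I.valid_idCtx h) (I.diag A) (I.isCtxMor_diag h)

theorem diagMor_comp_idProj (h : T.Valid (Γ.snoc A)) : diagMor I h ≫ idProj I h = wkMor h := by
  refine mor_congr (?_ : (I.diag A).init.init.init = Sub.wk S n)
  rw [IdFormers.diag, Sub.init_snoc, Sub.init_snoc, Sub.init_snoc]

theorem isPullback_idProj (hΞ : T.Valid Ξ) (hξ : T.IsCtxMor Ξ Γ ξ) (h : T.Valid (Γ.snoc A)) :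
    IsPullback (idProj I (valid_snoc_subst hΞ hξ h))
      (mor (I.valid_idCtx (valid_snoc_subst hΞ hξ h)) (I.valid_idCtx h) (Sub.lift 3 ξ)
        (I.isCtxMor_lift_three hΞ hξ h)) (mor hΞ h.1 ξ hξ) (idProj I h) := by
  have proj_append {Θ : Tel S k 3} (hΘ : (I.idTel A).subst ξ = Θ) (h₁ : T.Valid (Ξ.append Θ))
      (h₂ : T.IsCtxMor (Ξ.append Θ) (I.idCtx Γ A) (Sub.lift 3 ξ)) :
      IsPullback (proj Ξ Θ h₁) (mor h₁ (I.valid_idCtx h) (Sub.lift 3 ξ) h₂) (mor hΞ h.1 ξ hξ)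
        (proj Γ (I.idTel A) (I.valid_idCtx h)) := by
    subst hΘ
    exact isPullback_append hξ (I.idTel A) (I.valid_idCtx h) h₁ h₂
  exact proj_append (I.idTel_subst A ξ) _ _

theorem isPullback_diagMor (hΞ : T.Valid Ξ) (hξ : T.IsCtxMor Ξ Γ ξ) (h : T.Valid (Γ.snoc A)) :
    IsPullback (mor (valid_snoc_subst hΞ hξ h) h (Sub.lift 1 ξ) (isCtxMor_lift_one hΞ hξ h))
      (diagMor I (valid_snoc_subst hΞ hξ h)) (diagMor I h)
      (mor (I.valid_idCtx (valid_snoc_subst hΞ hξ h)) (I.valid_idCtx h) (Sub.lift 3 ξ)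
        (I.isCtxMor_lift_three hΞ hξ h)) := by
  refine (IsPullback.of_right ?_ ?_ (isPullback_idProj I hΞ hξ h)).flip
  · rw [diagMor_comp_idProj, diagMor_comp_idProj]
    exact isPullback_snoc hΞ hξ h
  · exact mor_congr (I.diag_comp A ξ).symm

theorem hasWeakLifting_of_isPullback_diagMor {h : T.Valid (Γ.snoc A)} {U E : ClassifyingCategory T}
    {δ : E ⟶ of (I.idCtx Γ A) (I.valid_idCtx h)} (hδ : Fib (display T) δ) {w : U ⟶ of (Γ.snoc A) h}
    {i : U ⟶ E} (hU : IsPullback w i (diagMor I h) δ) : HasWeakLifting (display T) i := by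
  obtain ⟨m, Δ, hV, e, he⟩ := exists_iso_proj_of_fib hδ
  obtain ⟨hU₀, hi⟩ := isCtxMor_lift h (I.isCtxMor_diag h) Δ hV
  have hP := isPullback_append (hΔ := h) (hΓ := I.valid_idCtx h) (I.isCtxMor_diag h) Δ hV hU₀ hi
  have hU' : IsPullback w (i ≫ e.hom) (diagMor I h) (proj _ Δ hV) :=
    hU.of_iso (Iso.refl _) (Iso.refl _) e (Iso.refl _) (by simp) (by simp) (by simp) (by simp [he])
  exact (hasWeakLifting_lift_diag I Δ h hV hU₀ hi).of_iso (hU'.isoIsPullback _ _ hP) e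
    (IsPullback.isoIsPullback_hom_snd _ _ _ _)

/-- The identity type of a type in the context `Γ`. -/
def idObj (h : T.Valid (Γ.snoc A)) : IdentityObject (display T) (wkMor h) where
  AA := of ((Γ.snoc A).snoc A.wk) (valid_snoc_wk h)
  I := of (I.idCtx Γ A) (I.valid_idCtx h)
  pr₁ := wkMor (valid_snoc_wk h)
  pr₂ := mor (valid_snoc_wk h) h (Sub.lift 1 (Sub.wk S n))
    (isCtxMor_lift_one h (isCtxMor_wk h) h)
  st := wkMor (I.valid_idCtx h)
  r := diagMor I h
  isPullback := isPullback_snoc_wk h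
  disp := display_wkMor _
  r_fst := by
    refine mor_congr (?_ : (I.diag A).init.init = Sub.id S (n + 1))
    rw [IdFormers.diag, Sub.init_snoc, Sub.init_snoc, Sub.wk_snoc_last]
  r_snd := by
    refine mor_congr (?_ : ((Sub.lift 1 (Sub.wk S n)).comp (Sub.wk S (n + 2))).comp (I.diag A) =
      Sub.id S (n + 1))
    rw [Sub.comp_assoc, Sub.wk_comp, IdFormers.diag, Sub.init_snoc, Sub.lift_one_comp_snoc,
      Sub.wk_comp, Sub.init_snoc, Sub.wk_snoc_last]
  weakLifting := by
    intro X K E U x k₁ k₂ δ w i hK hδ hU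
    induction X using ind with
    | h Ξ hΞ =>
    obtain ⟨ξ, hξ, rfl⟩ := exists_mor x
    have hK' := isPullback_idProj I hΞ hξ h
    have hdiag := isPullback_diagMor I hΞ hξ h
    let e := hK.isoIsPullback _ _ hK'
    have he : e.hom ≫ _ = k₂ := IsPullback.isoIsPullback_hom_snd _ _ hK hK'
    obtain ⟨w', hw, hw'⟩ := hdiag.exists_lift w (i ≫ δ ≫ e.hom) (by
      rw [hU.w, Category.assoc, Category.assoc, he])
    refine hasWeakLifting_of_isPullback_diagMor I (hδ.comp (.of_isIso e.hom)) (w := w') ?_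
    exact .of_right (by rwa [hw, Category.assoc, he]) (hw') hdiag

end IdentityContext

theorem hasIdentityTypes_display (I : PropIdTypes T) : HasIdentityTypes (display T) where
  exists_identityObject d hd := by
    obtain ⟨_, _, _, h, _, _, hP⟩ := hd.exists_isPullback
    obtain ⟨N, -⟩ := (idObj I h).exists_baseChange hP hd
    exact ⟨N⟩

end ClassifyingCategory

end DepTT

theorem mainTheorem1 {S : DepTT.Signature.{u}} (T : DepTT.TypeTheory S) (I : DepTT.PropIdTypes T) :
    ∃ W : CategoryTheory.MorphismProperty (DepTT.ClassifyingCategory T),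
      DepTT.IsPathCategory (DepTT.ClassifyingCategory.fibrations T) W := by
  have := DepTT.ClassifyingCategory.hasIdentityTypes_display I
  rw [← DepTT.ClassifyingCategory.fib_display]
  exact ⟨_, DepTT.isPathCategory_of_hasIdentityTypes DepTT.ClassifyingCategory.fib_from_nil⟩
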